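/- Let $U,V:\mathbb R^m\to\mathbb R$ be $C^2$ and such that $\pi(dq)=e^{-U(q)}dq$ (the target) and $G(dp)=e^{-V(p)}dp$ (the momentum distribution, not necessarily symmetric) are probability measures, with $\int|q|\,\pi(dq)<\infty$. Let $H(q,p)=U(q)+V(p)$, and assume that Hamilton's equations $\dot Q=\partial H/\partial p$, $\dot P=-\partial H/\partial q$ have, for every initial condition $(Q(0),P(0))=(q,p)$, a solution $(Q(t;q,p),P(t;q,p))$ for all $t\in\mathbb R$. Fix $T>0$, and assume the coverage property: for every $q$, the map $p\mapsto Q(T;q,p)$ is onto $\mathbb R^m$. Let $B_R=\{q:|q|\le R\}$ with $R>0$, and suppose that, in operator norm, $\left|\frac{\partial Q}{\partial q}(T;q,p)\right|\le\beta<1$ for all $q\notin B_R$ and all $p$, and that $\left|\frac{\partial Q}{\partial q}(T;q,p)\right|$ is bounded over $q\in B_R$ and all $p$. The HMC chain moves from $q$ to $Q(T;q,p)$, where $p\sim G$ is drawn afresh. Then there is $\varepsilon\in(0,1)$ such that this chain converges geometrically to $\pi$ in the Wasserstein metric $W_1$, with factor $\beta'=\max\{1-\varepsilon,\frac{1+\beta}{2}\}<1$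 per step: there is a constant $C$ such that for every initial probability measure $\mu_0$ with $\int|q|\,\mu_0(dq)<\infty$, the law $\mu_n$ of the chain after $n$ steps satisfies $$W_1(\mu_n,\pi)\le C\Bigl(1+\int|q|\,\mu_0(dq)\Bigr)\,\beta'^{\,n}\qquad\text{for all } n\ge 0.$$ If moreover $\left|\frac{\partial Q}{\partial q}(-T;q,p)\right|$ satisfies the same two bounds (at most $\beta$ for $q\notin B_R$, bounded for $q\in B_R$), then the same conclusion, with some $\varepsilon\in(0,1)$ and $C$, holds for the alternating direction chain (AD-HMC), each step of which moves from $q$ to $q'=Q(T;q,p)$ and then to $Q(-T;q',p')$, with independent fresh momenta $p,p'\sim G$. -/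

import Mathlib

open MeasureTheory
open scoped ENNReal Gradient

/-- The position space and the momentum space: Euclidean `m`-space. -/
abbrev Vec (m : ℕ) : Type := EuclideanSpace ℝ (Fin m)

/-- The Hamiltonian `H(q, p) = U(q) + V(p)`. -/
def hamiltonian {m : ℕ} (U V : Vec m → ℝ) (q p : Vec m) : ℝ := U q + V p

/-- `Q t q p` and `P t q p` are the position and the momentum at time `t` of the solution of
Hamilton's equations that starts at `(q, p)` at time `0`; all solutions exist for all times. -/
structure IsHamiltonianMotion {m : ℕ} (U V : Vec m → ℝ) (Q P : ℝ → Vec m → Vec m → Vec m) :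
    Prop where
  position_zero : ∀ q p, Q 0 q p = q
  momentum_zero : ∀ q p, P 0 q p = p
  position_deriv : ∀ q p t, HasDerivAt (fun s => Q s q p)
    (∇ (fun y => hamiltonian U V (Q t q p) y) (P t q p)) t
  momentum_deriv : ∀ q p t, HasDerivAt (fun s => P s q p)
    (-∇ (fun x => hamiltonian U V x (P t q p)) (Q t q p)) t

/-- The measure with density `exp (-W)` with respect to Lebesgue measure. -/
noncomputable def gibbs {m : ℕ} (W : Vec m → ℝ) : Measure (Vec m) :=
  (volume : Measure (Vec m)).withDensity (fun x => ENNReal.ofReal (Real.exp (-W x)))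

/-- Joint laws on `X × X` with first marginal `μ` and second marginal `ν`. -/
def IsCoupling {X : Type*} [MeasurableSpace X] (μ ν : Measure X) (γ : Measure (X × X)) : Prop :=
  γ.map Prod.fst = μ ∧ γ.map Prod.snd = ν

/-- The Wasserstein distance of order `p > 0`, with values in `[0, ∞]`. -/
noncomputable def wasserstein {X : Type*} [MeasurableSpace X] [PseudoEMetricSpace X] (p : ℝ)
    (μ ν : Measure X) : ℝ≥0∞ :=
  ⨅ (γ : Measure (X × X)) (_ : IsCoupling μ ν γ), (∫⁻ z, edist z.1 z.2 ^ p ∂γ) ^ (1 / p)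

/-- One step of the chain, as a map on laws: if the position `q` has law `μ`, draw a momentum `p`
from `G` independently of `q` and return the law of `Q t q p`. -/
noncomputable def hmcStep {m : ℕ} (Q : ℝ → Vec m → Vec m → Vec m) (G : Measure (Vec m)) (t : ℝ)
    (μ : Measure (Vec m)) : Measure (Vec m) :=
  (μ.prod G).map (fun z => Q t z.1 z.2)

/-- One step of the alternating direction chain: a forward motion of length `T`, followed by a
backward motion of length `T` with a fresh momentum. -/
noncomputable def adHmcStep {m : ℕ} (Q : ℝ → Vec m → Vec m → Vec m) (G : Measure (Vec m)) (T : ℝ)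
    (μ : Measure (Vec m)) : Measure (Vec m) :=
  hmcStep Q G (-T) (hmcStep Q G T μ)

/-- For the motion of (signed) length `t`, the operator norm of `∂Q/∂q` is at most `β` outside the
closed ball of radius `R` about the origin, and bounded inside it, for all momenta. -/
def SensitivityBound {m : ℕ} (Q : ℝ → Vec m → Vec m → Vec m) (t R β : ℝ) : Prop :=
  (∀ q p : Vec m, R < ‖q‖ → ‖fderiv ℝ (fun x => Q t x p) q‖ ≤ β) ∧
    ∃ M : ℝ, ∀ q p : Vec m, ‖q‖ ≤ R → ‖fderiv ℝ (fun x => Q t x p) q‖ ≤ M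

/-- Geometric convergence to `π` in `W₁` by the factor `r` per step, from every initial
probability measure with finite first moment, the constant growing at most linearly in that
moment. -/
def ConvergesGeometricallyW1 {m : ℕ} (step : Measure (Vec m) → Measure (Vec m))
    (π : Measure (Vec m)) (r : ℝ) : Prop :=
  ∃ C : ℝ, ∀ μ₀ : Measure (Vec m), IsProbabilityMeasure μ₀ → Integrable (fun q => ‖q‖) μ₀ →
    ∀ n : ℕ, wasserstein 1 (step^[n] μ₀) π ≤
      ENNReal.ofReal (C * (1 + ∫ q, ‖q‖ ∂μ₀) * r ^ n)

/-! The proof is Harris' theorem in the form of Hairer and Mattingly, with Lyapunov function `‖q‖`.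
A drift bound, together with mass shared by the transition laws from any two points of a bounded
set, makes one step contract a total variation distance weighted by `1 + b * ‖q‖`
(`exists_contraction_of_drift_of_minorization`). That distance dominates `b` times W₁, so an
invariant π attracts geometrically.

Invariance: the flow is differentiable with symplectic derivative, hence preserves Lebesgue measure;
it conserves H, hence preserves π ⊗ G, whose first marginal is π.

Drift: moving from q radially to B_R bounds |Q(T;q,p)| by β|q| + |Q(T;0,p)| + const
(`SensitivityBound.exists_norm_le`). The mean of |Q(T;0,p)| is finite because, by invariance,
Q(T;q,p) has finite mean for some q.

Shared mass: by Sard's theorem two starting points have a common regular value y. Coverage provides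
momenta leading from each point to y, and an inverse function theorem uniform in the starting point
bounds both laws below by a multiple of Lebesgue measure near y (`exists_nhds_common_lower_bound`).
Compactness makes the mass uniform.

Harris' theorem yields some factor r < 1, and ε = 1 - r; the maximum with (1 + β) / 2 only weakens
the rate. For AD-HMC both ingredients survive composition with the backward kernel. -/

/-- `φ t x` is the value at time `t` of the integral curve of the vector field `f` that starts
at `x`; all integral curves exist for all times. -/
structure IsGlobalFlow {E : Type*} [NormedAddCommGroup E] [NormedSpace ℝ E] (f : E → E)
    (φ : ℝ → E → E) : Prop where
  zero : ∀ x, φ 0 x = x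
  deriv : ∀ x t, HasDerivAt (fun s => φ s x) (f (φ t x)) t

/-! ### Differentiability of the flow of a C¹ vector field in its initial point -/

section Flow

open Set Filter Topology Metric

variable {E : Type*} [NormedAddCommGroup E] [NormedSpace ℝ E] {f : E → E} {φ : ℝ → E → E}

/-- The set of times of agreement is closed by continuity, and open because `f` is locally
Lipschitz. -/
theorem integralCurve_unique (hf : ContDiff ℝ 1 f) {x y : ℝ → E}
    (hx : ∀ t, HasDerivAt x (f (x t)) t) (hy : ∀ t, HasDerivAt y (f (y t)) t)
    (h0 : x 0 = y 0) (t : ℝ) : x t = y t := by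
  have hxc : Continuous x := continuous_iff_continuousAt.2 fun t => (hx t).continuousAt
  have hyc : Continuous y := continuous_iff_continuousAt.2 fun t => (hy t).continuousAt
  have hclopen : IsClopen {t | x t = y t} := by
    refine ⟨isClosed_eq hxc hyc, isOpen_iff_mem_nhds.2 fun t ht => ?_⟩
    obtain ⟨K, s, hs, hK⟩ := (hf.contDiffAt (x := x t)).exists_lipschitzOnWith
    refine ODE_solution_unique_of_eventually (v := fun _ => f) (s := fun _ => s) (K := K)
      (Eventually.of_forall fun _ => hK) ?_ ?_ ht
    · filter_upwards [hxc.continuousAt hs] with τ hτ using ⟨hx τ, hτ⟩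
    · have ht' : x t = y t := ht
      rw [ht'] at hs
      filter_upwards [hyc.continuousAt hs] with τ hτ using ⟨hy τ, hτ⟩
  exact eq_univ_iff_forall.1 (hclopen.eq_univ ⟨0, h0⟩) t

namespace IsGlobalFlow

theorem add (h : IsGlobalFlow f φ) (hf : ContDiff ℝ 1 f) (s t : ℝ) (x : E) :
    φ (s + t) x = φ s (φ t x) := by
  refine integralCurve_unique hf (x := fun s => φ (s + t) x) (y := fun s => φ s (φ t x))
    (fun τ => ?_) (h.deriv _) (by simp [h.zero]) s
  exact (h.deriv x (τ + t)).comp_add_const τ t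

theorem neg_apply (h : IsGlobalFlow f φ) (hf : ContDiff ℝ 1 f) (t : ℝ) (x : E) :
    φ (-t) (φ t x) = x := by
  rw [← h.add hf, neg_add_cancel, h.zero]

theorem reverse (h : IsGlobalFlow f φ) : IsGlobalFlow (fun x => -f x) (fun t => φ (-t)) where
  zero x := by simp [h.zero]
  deriv x t := by
    simpa using! (h.deriv x (-t)).scomp t (hasDerivAt_neg t)

theorem continuous_time (h : IsGlobalFlow f φ) (x : E) : Continuous fun t => φ t x :=
  continuous_iff_continuousAt.2 fun t => (h.deriv x t).continuousAt

theorem exists_local_lipschitz (h : IsGlobalFlow f φ) (hf : ContDiff ℝ 1 f) (x₀ : E) :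
    ∃ a > 0, ∃ K > 0, ∃ ε > 0, 2 * K * ε ≤ 1 ∧ (∀ y ∈ closedBall x₀ a, ‖fderiv ℝ f y‖ ≤ K) ∧
      (∀ z ∈ closedBall x₀ (a / 2), ∀ s ∈ Icc 0 ε, φ s z ∈ closedBall x₀ a) ∧
      ∀ z ∈ closedBall x₀ (a / 2), ∀ w ∈ closedBall x₀ (a / 2), ∀ s ∈ Icc 0 ε,
        dist (φ s z) (φ s w) ≤ dist z w * Real.exp (K * ε) := by
  have h1 : ∀ᶠ y in 𝓝 x₀, ‖f y‖ < ‖f x₀‖ + 1 :=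
    (hf.continuous.norm.continuousAt).eventually_lt continuousAt_const (by simp)
  have h2 : ∀ᶠ y in 𝓝 x₀, ‖fderiv ℝ f y‖ < ‖fderiv ℝ f x₀‖ + 1 :=
    ((hf.continuous_fderiv one_ne_zero).norm.continuousAt).eventually_lt continuousAt_const
      (by simp)
  obtain ⟨a, ha, hball⟩ := nhds_basis_closedBall.eventually_iff.1 (h1.and h2)
  set L := ‖f x₀‖ + 1
  set K := ‖fderiv ℝ f x₀‖ + 1 with hKdef
  have hL : 0 < L := by positivity
  have hK : 0 < K := by positivity
  -- The first bound keeps curves from the half ball inside the ball; the second is what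
  -- Picard–Lindelöf needs for the variational equation.
  set ε := min (a / (2 * (L + 1))) (1 / (2 * K)) with hεdef
  have hε : 0 < ε := by positivity
  have hεa : (L + 1) * ε ≤ a / 2 := by
    have : ε ≤ a / (2 * (L + 1)) := min_le_left _ _
    rw [le_div_iff₀ (by positivity)] at this
    linarith
  have hεK : 2 * K * ε ≤ 1 := by
    have : ε ≤ 1 / (2 * K) := min_le_right _ _
    rw [le_div_iff₀ (by positivity)] at this
    linarith
  have htrap : ∀ z ∈ closedBall x₀ (a / 2), ∀ s ∈ Icc 0 ε, φ s z ∈ closedBall x₀ a := by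
    intro z hz s hs
    have hB : ∀ t, HasDerivAt (fun t : ℝ => a / 2 + (L + 1) * t) (L + 1) t := fun t => by
      simpa using ((hasDerivAt_id t).const_mul (L + 1)).const_add (a / 2)
    -- Inside the ball the speed is below `L`, so the distance to `x₀` can never cross the barrier
    -- `a / 2 + (L + 1) * t`; the extra 1 makes the comparison strict.
    have := image_norm_le_of_norm_deriv_right_lt_deriv_boundary (a := 0) (b := ε)
      (f := fun t => φ t z - x₀) (f' := fun t => f (φ t z))
      ((h.continuous_time z).sub continuous_const).continuousOn
      (fun t _ => ((h.deriv z t).sub_const x₀).hasDerivWithinAt)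
      (by simpa [h.zero, dist_eq_norm] using hz) hB
      (fun t ht heq => by
        have hmem : φ t z ∈ closedBall x₀ a := by
          rw [mem_closedBall, dist_eq_norm, heq]
          nlinarith [ht.1, ht.2]
        linarith [(hball hmem).1]) hs
    rw [mem_closedBall, dist_eq_norm]
    refine this.trans ?_
    nlinarith [hs.1, hs.2]
  have hlip : LipschitzOnWith K.toNNReal f (closedBall x₀ a) := by
    refine (convex_closedBall x₀ a).lipschitzOnWith_of_nnnorm_fderiv_le
      (fun y _ => (hf.differentiable one_ne_zero) y) fun y hy => ?_
    rw [← NNReal.coe_le_coe, Real.coe_toNNReal _ hK.le]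
    exact (hball hy).2.le
  refine ⟨a, ha, K, hK, ε, hε, hεK, fun y hy => (hball hy).2.le, htrap, ?_⟩
  intro z hz w hw s hs
  have := dist_le_of_trajectories_ODE_of_mem (v := fun _ => f) (s := fun _ => closedBall x₀ a)
    (f := fun t => φ t z) (g := fun t => φ t w) (K := K.toNNReal) (a := 0) (b := ε)
    (δ := dist z w)
    (fun _ _ => hlip) (h.continuous_time z).continuousOn
    (fun t _ => (h.deriv z t).hasDerivWithinAt)
    (fun t ht => htrap z hz t (Ico_subset_Icc_self ht)) (h.continuous_time w).continuousOn
    (fun t _ => (h.deriv w t).hasDerivWithinAt)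
    (fun t ht => htrap w hw t (Ico_subset_Icc_self ht)) (by simp [h.zero]) s hs
  refine this.trans ?_
  rw [Real.coe_toNNReal _ hK.le, sub_zero]
  gcongr
  exact hs.2

/-- The derivative `M` solves the variational equation, and Grönwall controls the remainder. The
time `ε` is uniform for starting points near `x₀`, which later allows continuation to all times. -/
theorem exists_local_hasStrictFDerivAt_right [CompleteSpace E] (h : IsGlobalFlow f φ)
    (hf : ContDiff ℝ 1 f) (x₀ : E) :
    ∃ a > 0, ∃ ε > 0, ∀ z ∈ ball x₀ a, ∃ M : ℝ → E →L[ℝ] E,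
      HasDerivWithinAt M (fderiv ℝ f z) (Ici 0) 0 ∧
      ∀ s ∈ Icc 0 ε, HasStrictFDerivAt (φ s) (M s) z := by
  obtain ⟨a, ha, K, hK, ε, hε, hεK, hD, htrap, hlip⟩ := h.exists_local_lipschitz hf x₀
  refine ⟨a / 2, by positivity, ε, hε, fun z hz => ?_⟩
  have hDc : Continuous (fderiv ℝ f) := hf.continuous_fderiv one_ne_zero
  have hzc := ball_subset_closedBall hz
  have hDz : ∀ t ∈ Icc 0 ε, ‖fderiv ℝ f (φ t z)‖ ≤ K := fun t ht => hD _ (htrap z hzc t ht)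
  -- On the unit ball about the identity, `‖N‖ ≤ 2`, so the field is at most `2 * K`; then `2 * K *
  -- ε ≤ 1` keeps the solution in that ball.
  have hPL : IsPicardLindelof (fun t (N : E →L[ℝ] E) => (fderiv ℝ f (φ t z)).comp N)
      (tmin := 0) (tmax := ε) ⟨0, by simp [hε.le]⟩ (ContinuousLinearMap.id ℝ E) 1 0
      (2 * K.toNNReal) K.toNNReal := by
    refine ⟨fun t ht => ?_, fun N _ => ?_, fun t ht N hN => ?_, ?_⟩
    · refine LipschitzOnWith.of_dist_le_mul fun N _ N' _ => ?_
      rw [dist_eq_norm, dist_eq_norm, ← ContinuousLinearMap.comp_sub, Real.coe_toNNReal _ hK.le]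
      exact (ContinuousLinearMap.opNorm_comp_le _ _).trans (by gcongr; exact hDz t ht)
    · exact ((hDc.comp (h.continuous_time z)).clm_comp continuous_const).continuousOn
    · have hN2 : ‖N‖ ≤ 2 := by
        have h1 : ‖N - ContinuousLinearMap.id ℝ E‖ ≤ 1 := by
          simpa [dist_eq_norm] using hN
        have := norm_le_norm_add_norm_sub' N (ContinuousLinearMap.id ℝ E)
        linarith [ContinuousLinearMap.norm_id_le (𝕜 := ℝ) (E := E)]
      refine (ContinuousLinearMap.opNorm_comp_le _ _).trans ?_
      push_cast
      rw [Real.coe_toNNReal _ hK.le]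
      nlinarith [hDz t ht, norm_nonneg N, norm_nonneg (fderiv ℝ f (φ t z))]
    · push_cast
      rw [Real.coe_toNNReal _ hK.le]
      simpa [hε.le] using hεK
  obtain ⟨M, hM0, hM⟩ := hPL.exists_eq_forall_mem_Icc_hasDerivWithinAt₀
  simp only at hM0
  refine ⟨M, ?_, fun s hs => ?_⟩
  · have := hM 0 (by simp [hε.le])
    rw [hM0, h.zero, ContinuousLinearMap.comp_id] at this
    exact this.mono_of_mem_nhdsWithin (Icc_mem_nhdsGE hε)
  · rw [hasStrictFDerivAt_iff_isLittleO, Asymptotics.isLittleO_iff]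
    intro c hc
    set C := Real.exp (K * ε)
    have hC : 1 ≤ C := Real.one_le_exp (by positivity)
    -- One factor `C` is the Lipschitz constant of the flow, the other and the `K` come from
    -- Grönwall's bound.
    set c₁ := c * K / (C * C) with hc₁def
    have hc₁ : 0 < c₁ := by positivity
    obtain ⟨δ, hδ, hunif⟩ : ∃ δ > 0, ∀ t ∈ Icc 0 ε, ∀ y, dist (φ t z) y < δ →
        ‖fderiv ℝ f y - fderiv ℝ f (φ t z)‖ ≤ c₁ := by
      have hcomp : IsCompact ((fun t => φ t z) '' Icc 0 ε) :=
        isCompact_Icc.image (h.continuous_time z)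
      have := hcomp.uniformContinuousAt_of_continuousAt (fderiv ℝ f)
        (fun y _ => hDc.continuousAt) (dist_mem_uniformity hc₁)
      obtain ⟨δ, hδ, hsub⟩ := mem_uniformity_dist.1 this
      refine ⟨δ, hδ, fun t ht y hy => ?_⟩
      have := hsub hy (mem_image_of_mem _ ht)
      rw [← dist_eq_norm, dist_comm]
      exact le_of_lt this
    have hnear : ∀ᶠ w in 𝓝 z, w ∈ ball x₀ (a / 2) ∧ dist z w * C < δ := by
      refine (isOpen_ball.eventually_mem hz).and ?_
      have : Continuous fun w => dist z w * C := by fun_prop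
      exact this.continuousAt.eventually_lt continuousAt_const (by simpa using hδ)
    have hnear2 : ∀ᶠ p : E × E in 𝓝 (z, z), (p.1 ∈ ball x₀ (a / 2) ∧ dist z p.1 * C < δ) ∧
        (p.2 ∈ ball x₀ (a / 2) ∧ dist z p.2 * C < δ) := by
      rw [nhds_prod_eq]
      exact hnear.prod_mk hnear
    filter_upwards [hnear2] with p ⟨⟨hp1, hp1'⟩, hp2, hp2'⟩
    have hbound : ∀ t ∈ Icc 0 ε,
        ‖f (φ t p.1) - f (φ t p.2) - fderiv ℝ f (φ t z) (φ t p.1 - φ t p.2)‖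
          ≤ c₁ * (C * ‖p.1 - p.2‖) := by
      intro t ht
      have hm : ∀ w ∈ ball x₀ (a / 2), dist z w * C < δ → φ t w ∈ ball (φ t z) δ := by
        intro w hw hw'
        rw [mem_ball, dist_comm]
        exact (hlip z hzc w (ball_subset_closedBall hw) t ht).trans_lt hw'
      have := (convex_ball (φ t z) δ).norm_image_sub_le_of_norm_fderiv_le' (𝕜 := ℝ) (f := f)
        (φ := fderiv ℝ f (φ t z)) (C := c₁)
        (fun y _ => (hf.differentiable one_ne_zero) y)
        (fun y hy => hunif t ht y (by rwa [dist_comm])) (hm _ hp2 hp2') (hm _ hp1 hp1')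
      refine this.trans ?_
      have := hlip p.1 (ball_subset_closedBall hp1) p.2 (ball_subset_closedBall hp2) t ht
      rw [dist_eq_norm, dist_eq_norm] at this
      gcongr
      linarith
    have hgron := norm_le_gronwallBound_of_norm_deriv_right_le (a := 0) (b := ε) (δ := 0) (K := K)
      (ε := c₁ * (C * ‖p.1 - p.2‖))
      (f := fun t => φ t p.1 - φ t p.2 - M t (p.1 - p.2))
      (f' := fun t => f (φ t p.1) - f (φ t p.2) -
        ((fderiv ℝ f (φ t z)).comp (M t)) (p.1 - p.2))
      (((h.continuous_time _).sub (h.continuous_time _)).continuousOn.sub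
        (ContinuousOn.clm_apply (fun t ht => (hM t ht).continuousWithinAt) continuousOn_const))
      (fun t ht => by
        refine (((h.deriv _ t).sub (h.deriv _ t)).hasDerivWithinAt).sub ?_
        have := ((hM t (Ico_subset_Icc_self ht)).mono_of_mem_nhdsWithin
          (Icc_mem_nhdsGE_of_mem ht)).clm_apply (hasDerivWithinAt_const t (Ici t) (p.1 - p.2))
        simpa using this)
      (by simp [h.zero, hM0])
      (fun t ht => by
        have hsplit : f (φ t p.1) - f (φ t p.2) -
            ((fderiv ℝ f (φ t z)).comp (M t)) (p.1 - p.2) =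
            fderiv ℝ f (φ t z) (φ t p.1 - φ t p.2 - M t (p.1 - p.2)) +
            (f (φ t p.1) - f (φ t p.2) - fderiv ℝ f (φ t z) (φ t p.1 - φ t p.2)) := by
          simp only [map_sub, ContinuousLinearMap.comp_apply]
          abel
        rw [hsplit]
        have ht' := Ico_subset_Icc_self ht
        refine (norm_add_le _ _).trans (add_le_add ?_ (hbound t ht'))
        exact ((fderiv ℝ f (φ t z)).le_opNorm _).trans (by gcongr; exact hDz t ht')) s hs
    refine hgron.trans ?_
    rw [gronwallBound_of_K_ne_0 hK.ne', sub_zero]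
    have hexp : Real.exp (K * s) ≤ C := Real.exp_le_exp.2 (by gcongr; exact hs.2)
    have hCpos : 0 < C := by positivity
    calc 0 * Real.exp (K * s) + c₁ * (C * ‖p.1 - p.2‖) / K * (Real.exp (K * s) - 1)
        ≤ 0 + c₁ * (C * ‖p.1 - p.2‖) / K * C := by
          rw [zero_mul]
          gcongr
          linarith
      _ = c * ‖p.1 - p.2‖ := by
          rw [hc₁def]
          field_simp
          ring

theorem exists_local_hasStrictFDerivAt [CompleteSpace E] (h : IsGlobalFlow f φ)
    (hf : ContDiff ℝ 1 f) (x₀ : E) :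
    ∃ a > 0, ∃ ε > 0, ∀ z ∈ ball x₀ a,
      HasDerivAt (fun s => fderiv ℝ (φ s) z) (fderiv ℝ f z) 0 ∧
      ∀ s ∈ Icc (-ε) ε, HasStrictFDerivAt (φ s) (fderiv ℝ (φ s) z) z := by
  obtain ⟨a₁, ha₁, ε₁, hε₁, H₁⟩ := h.exists_local_hasStrictFDerivAt_right hf x₀
  obtain ⟨a₂, ha₂, ε₂, hε₂, H₂⟩ := h.reverse.exists_local_hasStrictFDerivAt_right hf.neg x₀
  refine ⟨min a₁ a₂, by positivity, min ε₁ ε₂, by positivity, fun z hz => ?_⟩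
  obtain ⟨M₁, hd₁, hs₁⟩ := H₁ z (ball_subset_ball (min_le_left _ _) hz)
  obtain ⟨M₂, hd₂, hs₂⟩ := H₂ z (ball_subset_ball (min_le_right _ _) hz)
  refine ⟨?_, fun s hs => ?_⟩
  · have e₁ : HasDerivWithinAt (fun s => fderiv ℝ (φ s) z) (fderiv ℝ f z) (Ici 0) 0 :=
      hd₁.congr_of_eventuallyEq_of_mem (by
        filter_upwards [Icc_mem_nhdsGE hε₁] with s hs using (hs₁ s hs).hasFDerivAt.fderiv) (by simp)
    have e₂ : HasDerivWithinAt (fun s => fderiv ℝ (φ (-s)) z) (-fderiv ℝ f z) (Ici 0) 0 := by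
      have := hd₂.congr_of_eventuallyEq_of_mem (f₁ := fun s => fderiv ℝ (φ (-s)) z) (by
        filter_upwards [Icc_mem_nhdsGE hε₂] with s hs using (hs₂ s hs).hasFDerivAt.fderiv) (by simp)
      rwa [fderiv_fun_neg] at this
    have e₃ : HasDerivWithinAt (fun s => fderiv ℝ (φ s) z) (fderiv ℝ f z) (Iic 0) 0 := by
      have e₂' : HasDerivWithinAt (fun s => fderiv ℝ (φ (-s)) z) (-fderiv ℝ f z) (Ici 0)
        (-(0 : ℝ)) := by simpa using e₂
      have := e₂'.scomp (0 : ℝ) (hasDerivWithinAt_neg (0 : ℝ) (Iic 0))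
        (fun s (hs : s ≤ 0) => by simpa using hs)
      simpa [Function.comp_def] using this
    have := e₃.union e₁
    rwa [Iic_union_Ici, hasDerivWithinAt_univ] at this
  · rcases le_total 0 s with h0 | h0
    · have := hs₁ s ⟨h0, hs.2.trans (min_le_left _ _)⟩
      rwa [this.hasFDerivAt.fderiv]
    · have := hs₂ (-s) ⟨by linarith, by linarith [hs.1, min_le_right ε₁ ε₂]⟩
      rw [neg_neg] at this
      rwa [this.hasFDerivAt.fderiv]

/-- By `φ s = φ (s - t) ∘ φ t` and the uniform short-time result, differentiability at one time near
`t₀` passes to every other time near `t₀`. Hence the good times form a clopen set. -/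
theorem hasStrictFDerivAt [CompleteSpace E] (h : IsGlobalFlow f φ)
    (hf : ContDiff ℝ 1 f) (t : ℝ) (x : E) :
    HasStrictFDerivAt (φ t) (fderiv ℝ (φ t) x) x := by
  suffices H : {t | ∃ A : E →L[ℝ] E, HasStrictFDerivAt (φ t) A x} = univ by
    obtain ⟨A, hA⟩ := H ▸ mem_univ t
    rwa [hA.hasFDerivAt.fderiv]
  have key : ∀ t₀, ∀ᶠ t in 𝓝 t₀, ∀ᶠ s in 𝓝 t₀,
      (∃ A : E →L[ℝ] E, HasStrictFDerivAt (φ t) A x) →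
        ∃ A : E →L[ℝ] E, HasStrictFDerivAt (φ s) A x := by
    intro t₀
    obtain ⟨a, ha, ε, hε, H⟩ := h.exists_local_hasStrictFDerivAt hf (φ t₀ x)
    filter_upwards [(h.continuous_time x).continuousAt (ball_mem_nhds _ ha),
      ball_mem_nhds t₀ (half_pos hε)] with t ht ht'
    filter_upwards [ball_mem_nhds t₀ (half_pos hε)] with s hs ⟨A, hA⟩
    have hst : s - t ∈ Icc (-ε) ε := by
      rw [Real.ball_eq_Ioo] at hs ht'
      exact ⟨by linarith [hs.1, ht'.2], by linarith [hs.2, ht'.1]⟩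
    refine ⟨_, (((H _ ht).2 _ hst).comp x hA).congr_of_eventuallyEq (Eventually.of_forall ?_)⟩
    intro y
    simp [← h.add hf]
  refine IsClopen.eq_univ ⟨?_, ?_⟩ ⟨0, ContinuousLinearMap.id ℝ E, ?_⟩
  · refine isClosed_iff_frequently.2 fun t₀ ht₀ => ?_
    obtain ⟨t, ht, ht'⟩ := (ht₀.and_eventually (key t₀)).exists
    exact ht'.self_of_nhds ht
  · refine isOpen_iff_mem_nhds.2 fun t₀ ht₀ => ?_
    filter_upwards [(key t₀).self_of_nhds] with s hs using hs ht₀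
  · exact (hasStrictFDerivAt_id x).congr_of_eventuallyEq
      (Eventually.of_forall fun y => (h.zero y).symm)

/-- The variational equation at time `t`, reduced to time 0 by the group law. -/
theorem hasDerivAt_fderiv [CompleteSpace E] (h : IsGlobalFlow f φ)
    (hf : ContDiff ℝ 1 f) (t : ℝ) (x : E) :
    HasDerivAt (fun s => fderiv ℝ (φ s) x)
      ((fderiv ℝ f (φ t x)).comp (fderiv ℝ (φ t) x)) t := by
  obtain ⟨a, ha, ε, hε, H⟩ := h.exists_local_hasStrictFDerivAt hf (φ t x)
  have h0 := (H _ (mem_ball_self ha)).1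
  have h1 : HasDerivAt (fun s => fderiv ℝ (φ (s - t)) (φ t x)) (fderiv ℝ f (φ t x)) t := by
    refine HasDerivAt.comp_sub_const (f := fun s => fderiv ℝ (φ s) (φ t x)) t t ?_
    simpa using h0
  have h2 := h1.clm_comp (hasDerivAt_const t (fderiv ℝ (φ t) x))
  simp only [ContinuousLinearMap.comp_zero, add_zero] at h2
  refine h2.congr_of_eventuallyEq (Eventually.of_forall fun s => ?_)
  have hcomp : φ s = φ (s - t) ∘ φ t := by
    ext y
    simp [← h.add hf]
  simp only
  conv_lhs => rw [hcomp]
  exact fderiv_comp x (h.hasStrictFDerivAt hf _ _).differentiableAt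
    (h.hasStrictFDerivAt hf _ _).differentiableAt

end IsGlobalFlow

end Flow

/-! ### Linear symplectic maps have determinant ±1 -/

section Symplectic

variable {F : Type*} [NormedAddCommGroup F] [InnerProductSpace ℝ F]

/-- The standard symplectic form on `F × F`. -/
def symplecticForm (F : Type*) [NormedAddCommGroup F] [InnerProductSpace ℝ F] :
    LinearMap.BilinForm ℝ (F × F) :=
  LinearMap.mk₂ ℝ (fun x y => inner ℝ x.1 y.2 - inner ℝ x.2 y.1)
    (fun x y z => by simp only [Prod.fst_add, Prod.snd_add, inner_add_left]; ring)
    (fun c x y => by simp only [Prod.smul_fst, Prod.smul_snd, inner_smul_left, smul_eq_mul,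
      RCLike.conj_to_real]; ring)
    (fun x y z => by simp only [Prod.fst_add, Prod.snd_add, inner_add_right]; ring)
    (fun c x y => by simp only [Prod.smul_fst, Prod.smul_snd, inner_smul_right, smul_eq_mul]; ring)

theorem symplecticForm_apply (x y : F × F) :
    symplecticForm F x y = inner ℝ x.1 y.2 - inner ℝ x.2 y.1 := rfl

theorem symplecticForm_nondegenerate : (symplecticForm F).Nondegenerate := by
  constructor
  · intro x hx
    have h1 := hx (0, x.1)
    have h2 := hx (x.2, 0)
    simp only [symplecticForm_apply, inner_zero_right, sub_zero, zero_sub, neg_eq_zero,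
      inner_self_eq_zero] at h1 h2
    exact Prod.ext h1 h2
  · intro x hx
    have h1 := hx (0, x.1)
    have h2 := hx (x.2, 0)
    simp only [symplecticForm_apply, inner_zero_left, sub_zero, zero_sub, neg_eq_zero,
      inner_self_eq_zero] at h1 h2
    exact Prod.ext h1 h2

/-- Taking determinants in `Mᵀ J M = J` gives `det M ^ 2 = 1`, which suffices for the change of
variables. -/
theorem abs_det_eq_one_of_preserves_symplecticForm [FiniteDimensional ℝ F]
    (M : (F × F) →L[ℝ] (F × F))
    (hM : ∀ u v, symplecticForm F (M u) (M v) = symplecticForm F u v) : |M.det| = 1 := by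
  classical
  let b := Module.finBasis ℝ (F × F)
  have hcomp : (symplecticForm F).comp M.toLinearMap M.toLinearMap = symplecticForm F := by
    ext u v <;> simpa using hM _ _
  have hdet := congrArg Matrix.det
    (LinearMap.BilinForm.toMatrix_comp b b (symplecticForm F) M.toLinearMap M.toLinearMap)
  rw [hcomp, Matrix.det_mul, Matrix.det_mul, Matrix.det_transpose, LinearMap.det_toMatrix] at hdet
  have hne := (LinearMap.BilinForm.nondegenerate_iff_det_ne_zero b).1
    (symplecticForm_nondegenerate (F := F))
  have hsq : M.det * M.det = 1 := by
    apply mul_left_cancel₀ hne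
    rw [mul_one]
    conv_rhs => rw [hdet]
    change _ = LinearMap.det M.toLinearMap * _ * LinearMap.det M.toLinearMap
    change _ * (LinearMap.det M.toLinearMap * LinearMap.det M.toLinearMap) = _
    ring
  rcases mul_self_eq_one_iff.1 hsq with h | h <;> simp [h]

end Symplectic

/-! ### Liouville's theorem, conservation of energy and invariance of the target -/

section Hamiltonian

variable {m : ℕ} {U V : Vec m → ℝ} {Q P : ℝ → Vec m → Vec m → Vec m}

theorem contDiff_gradient {W : Vec m → ℝ} (hW : ContDiff ℝ 2 W) : ContDiff ℝ 1 (∇ W) :=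
  (InnerProductSpace.toDual ℝ (Vec m)).symm.contDiff.comp (hW.fderiv_right (by norm_num))

theorem inner_fderiv_gradient_comm {W : Vec m → ℝ} (hW : ContDiff ℝ 2 W) (x a b : Vec m) :
    inner ℝ (fderiv ℝ (∇ W) x a) b = inner ℝ a (fderiv ℝ (∇ W) x b) := by
  have key : ∀ a b, inner ℝ (fderiv ℝ (∇ W) x a) b = fderiv ℝ (fderiv ℝ W) x a b := by
    intro a b
    have h1 : HasFDerivAt (fderiv ℝ W) (fderiv ℝ (fderiv ℝ W) x) x :=
      ((hW.fderiv_right (m := 1) (by norm_num)).differentiable one_ne_zero x).hasFDerivAt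
    have h2 := (InnerProductSpace.toDual ℝ (Vec m)).symm.toContinuousLinearEquiv.hasFDerivAt.comp x
      h1
    have h3 : fderiv ℝ (∇ W) x = _ := h2.fderiv
    rw [h3]
    exact InnerProductSpace.toDual_symm_apply
  rw [key, real_inner_comm, key]
  exact (hW.contDiffAt.isSymmSndFDerivAt (by simp)).eq a b

/-- The Hamiltonian vector field of `U q + V p`. -/
noncomputable def hamiltonianField (U V : Vec m → ℝ) (x : Vec m × Vec m) : Vec m × Vec m :=
  (∇ V x.2, -∇ U x.1)

/-- The phase flow of a Hamiltonian motion. -/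
def phaseFlow (Q P : ℝ → Vec m → Vec m → Vec m) (t : ℝ) (x : Vec m × Vec m) : Vec m × Vec m :=
  (Q t x.1 x.2, P t x.1 x.2)

theorem contDiff_hamiltonianField (hU : ContDiff ℝ 2 U) (hV : ContDiff ℝ 2 V) :
    ContDiff ℝ 1 (hamiltonianField U V) :=
  ((contDiff_gradient hV).comp contDiff_snd).prodMk ((contDiff_gradient hU).comp contDiff_fst).neg

theorem fderiv_hamiltonianField (hU : ContDiff ℝ 2 U) (hV : ContDiff ℝ 2 V)
    (x u : Vec m × Vec m) : fderiv ℝ (hamiltonianField U V) x u =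
      (fderiv ℝ (∇ V) x.2 u.2, -fderiv ℝ (∇ U) x.1 u.1) := by
  have h1 : HasFDerivAt (∇ V) (fderiv ℝ (∇ V) x.2) x.2 :=
    ((contDiff_gradient hV).differentiable one_ne_zero _).hasFDerivAt
  have h2 : HasFDerivAt (∇ U) (fderiv ℝ (∇ U) x.1) x.1 :=
    ((contDiff_gradient hU).differentiable one_ne_zero _).hasFDerivAt
  have := ((h1.comp x hasFDerivAt_snd).prodMk (h2.comp x hasFDerivAt_fst).neg).fderiv
  have h3 : fderiv ℝ (hamiltonianField U V) x = _ := this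
  rw [h3]
  rfl

theorem IsHamiltonianMotion.isGlobalFlow (h : IsHamiltonianMotion U V Q P) :
    IsGlobalFlow (hamiltonianField U V) (phaseFlow Q P) where
  zero x := by simp [phaseFlow, h.position_zero, h.momentum_zero]
  deriv x t := by
    have hq := h.position_deriv x.1 x.2 t
    have hp := h.momentum_deriv x.1 x.2 t
    have e1 : ∀ q p, ∇ (fun y => hamiltonian U V q y) p = ∇ V p := by
      intro q p
      simp [gradient, hamiltonian]
    have e2 : ∀ q p, ∇ (fun y => hamiltonian U V y p) q = ∇ U q := by
      intro q p
      simp [gradient, hamiltonian]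
    rw [e1] at hq
    rw [e2] at hp
    exact hq.prodMk hp

/-- Along the variational equation the symplectic form of two tangent vectors has zero derivative,
because the Hessians of `U` and `V` are symmetric. -/
theorem IsHamiltonianMotion.abs_det_fderiv (h : IsHamiltonianMotion U V Q P)
    (hU : ContDiff ℝ 2 U) (hV : ContDiff ℝ 2 V) (t : ℝ) (x : Vec m × Vec m) :
    |(fderiv ℝ (phaseFlow Q P t) x).det| = 1 := by
  have hflow := h.isGlobalFlow
  have hf := contDiff_hamiltonianField hU hV
  apply abs_det_eq_one_of_preserves_symplecticForm
  intro u v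
  have hd : ∀ u t, HasDerivAt (fun s => fderiv ℝ (phaseFlow Q P s) x u)
      (fderiv ℝ (hamiltonianField U V) (phaseFlow Q P t x) (fderiv ℝ (phaseFlow Q P t) x u)) t := by
    intro u t
    simpa using (hflow.hasDerivAt_fderiv hf t x).clm_apply (hasDerivAt_const t u)
  have hω : ∀ t, HasDerivAt (fun s => symplecticForm (Vec m) (fderiv ℝ (phaseFlow Q P s) x u)
      (fderiv ℝ (phaseFlow Q P s) x v)) 0 t := by
    intro t
    simp only [symplecticForm_apply]
    have hfst : ∀ u, HasDerivAt (fun s => (fderiv ℝ (phaseFlow Q P s) x u).1) _ t :=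
      fun u => (hd u t).fst
    have hsnd : ∀ u, HasDerivAt (fun s => (fderiv ℝ (phaseFlow Q P s) x u).2) _ t :=
      fun u => (hd u t).snd
    refine (((hfst u).inner ℝ (hsnd v)).sub ((hsnd u).inner ℝ (hfst v))).congr_deriv ?_
    simp only [fderiv_hamiltonianField hU hV, inner_neg_left, inner_neg_right]
    rw [inner_fderiv_gradient_comm hV, inner_fderiv_gradient_comm hU]
    ring
  have hconst := is_const_of_deriv_eq_zero (fun t => (hω t).differentiableAt)
    (fun t => (hω t).deriv) t 0
  have h0 : fderiv ℝ (phaseFlow Q P 0) x = ContinuousLinearMap.id ℝ _ := by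
    have : phaseFlow Q P 0 = id := funext hflow.zero
    rw [this, fderiv_id]
  simpa [h0] using hconst

theorem IsHamiltonianMotion.measurePreserving (h : IsHamiltonianMotion U V Q P)
    (hU : ContDiff ℝ 2 U) (hV : ContDiff ℝ 2 V) (t : ℝ) :
    MeasurePreserving (phaseFlow Q P t) := by
  have hflow := h.isGlobalFlow
  have hf := contDiff_hamiltonianField hU hV
  have hcont : ∀ t, Continuous (phaseFlow Q P t) := fun t =>
    continuous_iff_continuousAt.2 fun x => (hflow.hasStrictFDerivAt hf t x).continuousAt
  refine ⟨(hcont t).measurable, ?_⟩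
  ext s hs
  rw [Measure.map_apply (hcont t).measurable hs]
  have himage : phaseFlow Q P t ⁻¹' s = phaseFlow Q P (-t) '' s := by
    ext x
    constructor
    · intro hx
      exact ⟨_, hx, hflow.neg_apply hf t x⟩
    · rintro ⟨y, hy, rfl⟩
      have := hflow.neg_apply hf (-t) y
      rw [neg_neg] at this
      simpa [this] using hy
  have hinj : Set.InjOn (phaseFlow Q P (-t)) s := by
    intro x _ y _ hxy
    rw [← hflow.neg_apply hf (-t) x, ← hflow.neg_apply hf (-t) y, hxy]
  have hhaar : (volume : Measure (Vec m × Vec m)).IsAddHaarMeasure :=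
    inferInstanceAs ((volume : Measure (Vec m)).prod volume).IsAddHaarMeasure
  rw [himage, ← lintegral_abs_det_fderiv_eq_addHaar_image volume hs
    (fun x _ => (hflow.hasStrictFDerivAt hf (-t) x).hasFDerivAt.hasFDerivWithinAt) hinj]
  simp [h.abs_det_fderiv hU hV]

theorem IsHamiltonianMotion.hamiltonian_const (h : IsHamiltonianMotion U V Q P)
    (hU : ContDiff ℝ 2 U) (hV : ContDiff ℝ 2 V) (t : ℝ) (q p : Vec m) :
    hamiltonian U V (Q t q p) (P t q p) = hamiltonian U V q p := by
  have hd : ∀ t, HasDerivAt (fun s => hamiltonian U V (Q s q p) (P s q p)) 0 t := by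
    intro t
    have hz := h.isGlobalFlow.deriv (q, p) t
    have hq : HasDerivAt (fun s => Q s q p) (∇ V (P t q p)) t := hz.fst
    have hp : HasDerivAt (fun s => P s q p) (-∇ U (Q t q p)) t := hz.snd
    have h1 := ((hU.differentiable two_ne_zero (Q t q p)).hasFDerivAt).comp_hasDerivAt t hq
    have h2 := ((hV.differentiable two_ne_zero (P t q p)).hasFDerivAt).comp_hasDerivAt t hp
    have := h1.add h2
    rw [← toDual_gradient, ← toDual_gradient, InnerProductSpace.toDual_apply_apply,
      InnerProductSpace.toDual_apply_apply, inner_neg_right, real_inner_comm, add_neg_cancel]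
      at this
    exact this
  have := is_const_of_deriv_eq_zero (fun t => (hd t).differentiableAt) (fun t => (hd t).deriv) t 0
  simpa [h.position_zero, h.momentum_zero] using this

theorem measurable_gibbs_density {W : Vec m → ℝ} (hW : ContDiff ℝ 2 W) :
    Measurable fun x => ENNReal.ofReal (Real.exp (-W x)) :=
  (Real.measurable_exp.comp hW.continuous.measurable.neg).ennreal_ofReal

theorem gibbs_prod_gibbs (hU : ContDiff ℝ 2 U) (hV : ContDiff ℝ 2 V) :
    (gibbs U).prod (gibbs V) = (volume : Measure (Vec m × Vec m)).withDensity
      fun x => ENNReal.ofReal (Real.exp (-hamiltonian U V x.1 x.2)) := by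
  rw [gibbs, gibbs, prod_withDensity (measurable_gibbs_density hU) (measurable_gibbs_density hV)]
  congr 1
  ext x
  rw [← ENNReal.ofReal_mul (by positivity), ← Real.exp_add, hamiltonian]
  ring_nf

theorem IsHamiltonianMotion.map_gibbs_prod (h : IsHamiltonianMotion U V Q P)
    (hU : ContDiff ℝ 2 U) (hV : ContDiff ℝ 2 V) (t : ℝ) :
    ((gibbs U).prod (gibbs V)).map (phaseFlow Q P t) = (gibbs U).prod (gibbs V) := by
  have hmp := h.measurePreserving hU hV t
  rw [gibbs_prod_gibbs hU hV]
  have hmeas : Measurable fun x : Vec m × Vec m =>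
      ENNReal.ofReal (Real.exp (-hamiltonian U V x.1 x.2)) := by
    have h1 := hU.continuous
    have h2 := hV.continuous
    unfold hamiltonian
    fun_prop
  ext s hs
  rw [Measure.map_apply hmp.measurable hs, withDensity_apply _ hs,
    withDensity_apply _ (hmp.measurable hs), ← hmp.setLIntegral_comp_preimage hs hmeas]
  simp [phaseFlow, h.hamiltonian_const hU hV]

theorem IsHamiltonianMotion.continuous_position (h : IsHamiltonianMotion U V Q P)
    (hU : ContDiff ℝ 2 U) (hV : ContDiff ℝ 2 V) (t : ℝ) :
    Continuous fun z : Vec m × Vec m => Q t z.1 z.2 :=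
  continuous_iff_continuousAt.2 fun x => ((h.isGlobalFlow.hasStrictFDerivAt
    (contDiff_hamiltonianField hU hV) t x).continuousAt).fst

theorem IsHamiltonianMotion.hasStrictFDerivAt_position (h : IsHamiltonianMotion U V Q P)
    (hU : ContDiff ℝ 2 U) (hV : ContDiff ℝ 2 V) (t : ℝ) (x : Vec m × Vec m) :
    ∃ A : Vec m × Vec m →L[ℝ] Vec m,
      HasStrictFDerivAt (fun z : Vec m × Vec m => Q t z.1 z.2) A x :=
  ⟨_, (h.isGlobalFlow.hasStrictFDerivAt (contDiff_hamiltonianField hU hV) t x).fst⟩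

theorem IsHamiltonianMotion.differentiable_position (h : IsHamiltonianMotion U V Q P)
    (hU : ContDiff ℝ 2 U) (hV : ContDiff ℝ 2 V) (t : ℝ) (p : Vec m) :
    Differentiable ℝ fun q => Q t q p := fun q => by
  obtain ⟨A, hA⟩ := h.hasStrictFDerivAt_position hU hV t (q, p)
  exact DifferentiableAt.comp (g := fun z : Vec m × Vec m => Q t z.1 z.2) (f := fun q => (q, p)) q
    hA.differentiableAt (hasFDerivAt_prodMk_left q p).differentiableAt

/-- The step is the first marginal of the flow applied to an invariant product law. Reversibility
plays no part, so no symmetry of `V` is needed. -/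
theorem IsHamiltonianMotion.hmcStep_gibbs (h : IsHamiltonianMotion U V Q P)
    (hU : ContDiff ℝ 2 U) (hV : ContDiff ℝ 2 V) (hVprob : IsProbabilityMeasure (gibbs V)) (t : ℝ) :
    hmcStep Q (gibbs V) t (gibbs U) = gibbs U := by
  have hmp := h.measurePreserving hU hV t
  have : (fun z : Vec m × Vec m => Q t z.1 z.2) = Prod.fst ∘ phaseFlow Q P t := rfl
  rw [hmcStep, this, ← Measure.map_map measurable_fst hmp.measurable, h.map_gibbs_prod hU hV,
    Measure.map_fst_prod]
  simp

end Hamiltonian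

/-! ### Harris' theorem in dual form, on test functions of bounded weighted oscillation -/

section Harris

open ProbabilityTheory

/-- Turns a weighted oscillation bound into a weighted sup bound after centring; `c` is the supremum
of `φ - W`. -/
theorem exists_abs_sub_le_of_sub_le {X : Type*} [Nonempty X] {W φ : X → ℝ}
    (h : ∀ x y, φ x - φ y ≤ W x + W y) : ∃ c, ∀ x, |φ x - c| ≤ W x := by
  have hbdd : BddAbove (Set.range fun x => φ x - W x) := by
    obtain ⟨y⟩ := ‹Nonempty X›
    refine ⟨φ y + W y, ?_⟩
    rintro _ ⟨x, rfl⟩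
    linarith [h x y]
  refine ⟨⨆ x, (φ x - W x), fun x => abs_le.2 ⟨?_, ?_⟩⟩
  · have : ⨆ y, (φ y - W y) ≤ φ x + W x := ciSup_le fun y => by linarith [h y x]
    linarith
  · linarith [le_ciSup hbdd x]

variable {X : Type*} [MeasurableSpace X]

theorem integrable_of_abs_sub_le {μ : Measure X} [IsFiniteMeasure μ] {W φ : X → ℝ} {c : ℝ}
    (hφ : Measurable φ) (hc : ∀ x, |φ x - c| ≤ W x) (hW : Integrable W μ) : Integrable φ μ := by
  have h1 : Integrable (fun x => φ x - c) μ :=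
    hW.mono' (hφ.sub_const c).aestronglyMeasurable (Filter.Eventually.of_forall hc)
  exact (h1.add (integrable_const c)).congr (Filter.Eventually.of_forall fun x => by simp)

theorem abs_integral_sub_integral_le_of_le {μ ν : Measure X} [IsFiniteMeasure μ] (hνμ : ν ≤ μ)
    {W ψ : X → ℝ} (hψ : Measurable ψ) (hbound : ∀ x, |ψ x| ≤ W x) (hW : Integrable W μ) :
    |∫ x, ψ x ∂μ - ∫ x, ψ x ∂ν| ≤ ∫ x, W x ∂μ - ∫ x, W x ∂ν := by
  have hfin : IsFiniteMeasure ν := isFiniteMeasure_of_le μ hνμ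
  have hsplit : μ - ν + ν = μ := Measure.sub_add_cancel_of_le hνμ
  have hαμ : μ - ν ≤ μ := Measure.sub_le
  have hψi : Integrable ψ μ := hW.mono' hψ.aestronglyMeasurable (Filter.Eventually.of_forall hbound)
  have key : ∀ f : X → ℝ, Integrable f μ →
      ∫ x, f x ∂μ - ∫ x, f x ∂ν = ∫ x, f x ∂(μ - ν) := by
    intro f hf
    conv_lhs => rw [← hsplit]
    rw [integral_add_measure (hf.mono_measure hαμ) (hf.mono_measure hνμ)]
    ring
  rw [key ψ hψi, key W hW]
  refine (abs_integral_le_integral_abs).trans ?_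
  exact integral_mono (hψi.mono_measure hαμ).abs (hW.mono_measure hαμ) hbound

/-- If `V x + V y` is large, drift alone gives the contraction. If it is small, the shared mass `ε`
saves `2 * ε`, and `b` is so small that the drift constant costs at most `ε` of it. -/
theorem exists_contraction_of_drift_of_minorization [Nonempty X] (κ : Kernel X X)
    [IsMarkovKernel κ] {V : X → ℝ} (hV0 : ∀ x, 0 ≤ V x)
    (hVi : ∀ x, Integrable V (κ x)) {γ K : ℝ} (hγ0 : 0 ≤ γ) (hγ1 : γ < 1) (hK : 0 ≤ K)
    (hdrift : ∀ x, ∫ y, V y ∂κ x ≤ γ * V x + K)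
    (hminor : ∀ D : ℝ, ∃ ε > 0, ∀ x y, V x ≤ D → V y ≤ D →
      ∃ ν : Measure X, ν ≤ κ x ∧ ν ≤ κ y ∧ ε ≤ ν.real Set.univ) :
    ∃ b > 0, ∃ r, 0 < r ∧ r < 1 ∧ ∀ φ : X → ℝ, Measurable φ →
      (∀ x y, φ x - φ y ≤ (1 + b * V x) + (1 + b * V y)) →
      ∀ x y, ∫ z, φ z ∂κ x - ∫ z, φ z ∂κ y ≤ r * ((1 + b * V x) + (1 + b * V y)) := by
  -- The first term makes `2 * b * K` at most a quarter of the gain from drift; the `+ 1` gives `V x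
  -- + V y ≥ 1`, so that this gain also beats the constant 2 in the weights.
  set D := 8 * K / (1 - γ) + 1 with hD
  have hg : 0 < 1 - γ := by linarith
  obtain ⟨ε, hε, hmin⟩ := hminor D
  set b := ε / (2 * (K + 1)) with hb
  have hbpos : 0 < b := by positivity
  have hbK : 2 * (b * K) ≤ ε := by
    have : b * (2 * (K + 1)) = ε := by rw [hb]; field_simp
    nlinarith
  set η := min (min ((1 - γ) / 4) ((1 - γ) * b / 4)) (ε / 2) with hη
  have hη0 : 0 < η := by positivity
  have hη1 : η ≤ (1 - γ) / 4 := (min_le_left _ _).trans (min_le_left _ _)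
  have hη2 : η ≤ (1 - γ) * b / 4 := (min_le_left _ _).trans (min_le_right _ _)
  have hη3 : η ≤ ε / 2 := min_le_right _ _
  refine ⟨b, hbpos, 1 - η, by linarith, by linarith, fun φ hφ hosc x y => ?_⟩
  obtain ⟨c, hc⟩ := exists_abs_sub_le_of_sub_le hosc
  have hWi : ∀ x, Integrable (fun z => 1 + b * V z) (κ x) := fun x =>
    (integrable_const 1).add ((hVi x).const_mul b)
  have hWint : ∀ x, ∫ z, (1 + b * V z) ∂κ x ≤ 1 + b * (γ * V x + K) := by
    intro x
    rw [integral_add (integrable_const 1) ((hVi x).const_mul b), integral_const_mul]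
    simp only [integral_const, probReal_univ, smul_eq_mul, mul_one]
    have := mul_le_mul_of_nonneg_left (hdrift x) hbpos.le
    linarith
  have hshift : ∀ x, ∫ z, (φ z - c) ∂κ x = ∫ z, φ z ∂κ x - c := by
    intro x
    rw [integral_sub (integrable_of_abs_sub_le hφ hc (hWi x)) (integrable_const c)]
    simp
  -- Integrals over the common part `ν` cancel, and since the weight is at least 1, each of the two
  -- weighted integrals drops by at least `δ`.
  have hmain : ∀ (δ : ℝ) (ν : Measure X), ν ≤ κ x → ν ≤ κ y → δ ≤ ν.real Set.univ →
      ∫ z, φ z ∂κ x - ∫ z, φ z ∂κ y ≤ 2 + b * (γ * (V x + V y) + 2 * K) - 2 * δ := by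
    intro δ ν hx hy hδ
    have hfin : IsFiniteMeasure ν := isFiniteMeasure_of_le _ hx
    have h1 := abs_le.1 (abs_integral_sub_integral_le_of_le hx (hφ.sub_const c) hc (hWi x))
    have h2 := abs_le.1 (abs_integral_sub_integral_le_of_le hy (hφ.sub_const c) hc (hWi y))
    rw [hshift] at h1 h2
    have h3 : ν.real Set.univ ≤ ∫ z, (1 + b * V z) ∂ν := by
      have := integral_mono (μ := ν) (integrable_const (1 : ℝ)) ((hWi x).mono_measure hx)
        (fun z => by have := mul_nonneg hbpos.le (hV0 z); simpa using this)
      simpa using this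
    linarith [hWint x, hWint y, h1.2, h2.1]
  rcases lt_or_ge (V x + V y) D with hlt | hge
  · obtain ⟨ν, hx, hy, hν⟩ := hmin x y (by linarith [hV0 y]) (by linarith [hV0 x])
    have hS : 0 ≤ b * (V x + V y) := mul_nonneg hbpos.le (add_nonneg (hV0 x) (hV0 y))
    have := hmain ε ν hx hy hν
    nlinarith
  · have := hmain 0 0 (Measure.zero_le _) (Measure.zero_le _) (by simp)
    have hS1 : 1 ≤ V x + V y := by
      have : 0 ≤ 8 * K / (1 - γ) := by positivity
      linarith
    have hSK : 8 * K ≤ (1 - γ) * (V x + V y) := by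
      have h8 : 8 * K / (1 - γ) ≤ V x + V y := by linarith
      rw [div_le_iff₀ hg] at h8
      linarith
    have hbS : b ≤ b * (V x + V y) := le_mul_of_one_le_right hbpos.le hS1
    have e1 : b * (8 * K) ≤ b * ((1 - γ) * (V x + V y)) := mul_le_mul_of_nonneg_left hSK hbpos.le
    have e2 : η * (b * (V x + V y)) ≤ (1 - γ) / 4 * (b * (V x + V y)) :=
      mul_le_mul_of_nonneg_right hη1 (by linarith)
    have e3 : (1 - γ) * b ≤ (1 - γ) * (b * (V x + V y)) := mul_le_mul_of_nonneg_left hbS hg.le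
    nlinarith

theorem integrable_comp_of_drift (κ : Kernel X X) [IsMarkovKernel κ] {V : X → ℝ}
    (hVm : Measurable V) (hV0 : ∀ x, 0 ≤ V x) (hVi : ∀ x, Integrable V (κ x)) {γ K : ℝ}
    (hdrift : ∀ x, ∫ y, V y ∂κ x ≤ γ * V x + K) (μ : Measure X) [IsFiniteMeasure μ]
    (hμ : Integrable V μ) : Integrable V (κ ∘ₘ μ) := by
  rw [Measure.integrable_comp_iff hVm.aestronglyMeasurable]
  refine ⟨Filter.Eventually.of_forall hVi, ?_⟩
  refine ((hμ.const_mul γ).add (integrable_const K)).mono'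
    (hVm.stronglyMeasurable.norm.integral_kernel).aestronglyMeasurable
    (Filter.Eventually.of_forall fun x => ?_)
  rw [Real.norm_of_nonneg (integral_nonneg fun _ => norm_nonneg _)]
  simpa [abs_of_nonneg (hV0 _)] using hdrift x

theorem integral_iterate_sub_le [Nonempty X] (κ : Kernel X X) [IsMarkovKernel κ]
    {W : X → ℝ} {r : ℝ} (hr : 0 < r)
    (hWi : ∀ μ : Measure X, IsProbabilityMeasure μ → Integrable W μ → Integrable W (κ ∘ₘ μ))
    (hcontr : ∀ φ : X → ℝ, Measurable φ → (∀ x y, φ x - φ y ≤ W x + W y) →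
      ∀ x y, ∫ z, φ z ∂κ x - ∫ z, φ z ∂κ y ≤ r * (W x + W y))
    {μ ν : ℕ → Measure X} (hμ : ∀ n, IsProbabilityMeasure (μ n))
    (hν : ∀ n, IsProbabilityMeasure (ν n)) (hμs : ∀ n, μ (n + 1) = κ ∘ₘ μ n)
    (hνs : ∀ n, ν (n + 1) = κ ∘ₘ ν n) (hWμ : Integrable W (μ 0)) (hWν : Integrable W (ν 0))
    (n : ℕ) (φ : X → ℝ) (hφ : Measurable φ) (hosc : ∀ x y, φ x - φ y ≤ W x + W y) :
    ∫ x, φ x ∂μ n - ∫ x, φ x ∂ν n ≤ r ^ n * (∫ x, W x ∂μ 0 + ∫ x, W x ∂ν 0) := by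
  have hWμn : ∀ n, Integrable W (μ n) := fun n => by
    induction n with
    | zero => exact hWμ
    | succ n ih => rw [hμs]; exact hWi _ (hμ n) ih
  have hWνn : ∀ n, Integrable W (ν n) := fun n => by
    induction n with
    | zero => exact hWν
    | succ n ih => rw [hνs]; exact hWi _ (hν n) ih
  induction n generalizing φ with
  | zero =>
    obtain ⟨c, hc⟩ := exists_abs_sub_le_of_sub_le hosc
    have hμ0 := hμ 0
    have hν0 := hν 0
    have h1 : ∫ x, φ x ∂μ 0 ≤ ∫ x, (W x + c) ∂μ 0 :=
      integral_mono (integrable_of_abs_sub_le hφ hc hWμ) (hWμ.add (integrable_const c))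
        fun x => by linarith [(abs_le.1 (hc x)).2]
    have h2 : ∫ x, (c - W x) ∂ν 0 ≤ ∫ x, φ x ∂ν 0 :=
      integral_mono ((integrable_const c).sub hWν) (integrable_of_abs_sub_le hφ hc hWν)
        fun x => by linarith [(abs_le.1 (hc x)).1]
    rw [integral_add hWμ (integrable_const c)] at h1
    rw [integral_sub (integrable_const c) hWν] at h2
    simp only [integral_const, probReal_univ, smul_eq_mul, one_mul] at h1 h2
    linarith
  | succ n ih =>
    obtain ⟨c, hc⟩ := exists_abs_sub_le_of_sub_le hosc
    have hcomp : ∀ ρ : Measure X, IsProbabilityMeasure ρ → Integrable W (κ ∘ₘ ρ) →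
        ∫ x, φ x ∂(κ ∘ₘ ρ) = ∫ x, ∫ y, φ y ∂κ x ∂ρ := fun ρ _ hρ => by
      have hφi := integrable_of_abs_sub_le hφ hc hρ
      rw [Measure.comp_eq_comp_const_apply] at hφi ⊢
      exact Kernel.integral_comp hφi
    rw [hμs, hνs, hcomp _ (hμ n) (hμs n ▸ hWμn (n + 1)), hcomp _ (hν n) (hνs n ▸ hWνn (n + 1))]
    -- The contraction says exactly that `r⁻¹` times the averaged test function is again admissible.
    have := ih (fun x => r⁻¹ * ∫ y, φ y ∂κ x)
      ((hφ.stronglyMeasurable.integral_kernel).measurable.const_mul _) (fun x y => by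
        rw [← mul_sub, inv_mul_le_iff₀ hr]
        exact hcontr φ hφ hosc x y)
    simp only [integral_const_mul] at this
    rw [← mul_sub, inv_mul_le_iff₀ hr] at this
    rw [pow_succ']
    linarith

end Harris

/-! ### W₁ is dominated by weighted total variation -/

section Wasserstein

variable {E : Type*} [NormedAddCommGroup E] [MeasurableSpace E] [BorelSpace E]
  [SecondCountableTopology E]

/-- The coupling leaves `η` on the diagonal and joins the remainders independently, at cost at most
`‖x‖ + ‖y‖`. -/
theorem wasserstein_one_le_of_common_part {α α' η : Measure E} [IsFiniteMeasure α]
    [IsFiniteMeasure α'] [IsFiniteMeasure η] (hmass : α Set.univ = α' Set.univ) :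
    wasserstein 1 (η + α) (η + α') ≤ ∫⁻ x, ‖x‖ₑ ∂α + ∫⁻ x, ‖x‖ₑ ∂α' := by
  set θ := α Set.univ with hθ
  have hθtop : θ ≠ ∞ := measure_ne_top α _
  have hdiag : Measurable fun x : E => (x, x) := measurable_id.prodMk measurable_id
  have hscale : ∀ ρ : Measure E, ρ Set.univ = θ → θ⁻¹ • θ • ρ = ρ := by
    intro ρ hρ
    rcases eq_or_ne θ 0 with h0 | h0
    · rw [h0, Measure.measure_univ_eq_zero] at hρ
      simp [hρ]
    · rw [smul_smul, ENNReal.inv_mul_cancel h0 hθtop, one_smul]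
  set γ := η.map (fun x : E => (x, x)) + θ⁻¹ • α.prod α' with hγ
  have hcoupling : IsCoupling (η + α) (η + α') γ := by
    constructor
    · rw [hγ, Measure.map_add _ _ measurable_fst, Measure.map_smul,
        Measure.map_map measurable_fst hdiag, Measure.map_fst_prod, ← hmass, hscale α rfl]
      simp [Function.comp_def]
    · rw [hγ, Measure.map_add _ _ measurable_snd, Measure.map_smul,
        Measure.map_map measurable_snd hdiag, Measure.map_snd_prod, ← hθ, hscale α' hmass.symm]
      simp [Function.comp_def]
  have hcost : ∫⁻ z, edist z.1 z.2 ∂γ ≤ ∫⁻ x, ‖x‖ₑ ∂α + ∫⁻ x, ‖x‖ₑ ∂α' := by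
    rw [hγ, lintegral_add_measure, lintegral_smul_measure, lintegral_map (by fun_prop) hdiag]
    simp only [edist_self, lintegral_zero, zero_add, smul_eq_mul]
    have h1 : ∫⁻ z, edist z.1 z.2 ∂α.prod α' ≤ ∫⁻ z, (‖z.1‖ₑ + ‖z.2‖ₑ) ∂α.prod α' :=
      lintegral_mono fun z => by
        rw [edist_eq_enorm_sub]
        exact enorm_sub_le
    have h2 : ∫⁻ z, (‖z.1‖ₑ + ‖z.2‖ₑ) ∂α.prod α' = θ * (∫⁻ x, ‖x‖ₑ ∂α + ∫⁻ x, ‖x‖ₑ ∂α') := by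
      rw [lintegral_prod _ (by fun_prop)]
      simp only [lintegral_add_left' aemeasurable_const, lintegral_const]
      rw [lintegral_add_left (by fun_prop), lintegral_const, lintegral_mul_const _ (by fun_prop),
        ← hmass, ← hθ]
      ring
    calc θ⁻¹ * ∫⁻ z, edist z.1 z.2 ∂α.prod α'
        ≤ θ⁻¹ * (θ * (∫⁻ x, ‖x‖ₑ ∂α + ∫⁻ x, ‖x‖ₑ ∂α')) := by
          gcongr
          exact h1.trans h2.le
      _ ≤ 1 * (∫⁻ x, ‖x‖ₑ ∂α + ∫⁻ x, ‖x‖ₑ ∂α') := by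
          rw [← mul_assoc]
          gcongr
          exact ENNReal.inv_mul_le_one _
      _ = _ := one_mul _
  refine (iInf₂_le γ hcoupling).trans ?_
  simpa using hcost

/-- Testing with plus or minus the weight on the two Hahn sets bounds the weighted mass of both
remainders by `δ`. -/
theorem wasserstein_one_le_of_integral_sub_le {μ ν : Measure E} [IsProbabilityMeasure μ]
    [IsProbabilityMeasure ν] (hμ : Integrable (fun x => ‖x‖) μ)
    (hν : Integrable (fun x => ‖x‖) ν) {b δ : ℝ} (hb : 0 < b)
    (h : ∀ φ : E → ℝ, Measurable φ →
      (∀ x y, φ x - φ y ≤ (1 + b * ‖x‖) + (1 + b * ‖y‖)) → ∫ x, φ x ∂μ - ∫ x, φ x ∂ν ≤ δ) :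
    wasserstein 1 μ ν ≤ ENNReal.ofReal (b⁻¹ * δ) := by
  obtain ⟨s, hs, hs1, hs2⟩ := hahn_decomposition μ ν
  have hle1 : ν.restrict s ≤ μ.restrict s := by
    refine Measure.le_iff.2 fun t ht => ?_
    rw [Measure.restrict_apply ht, Measure.restrict_apply ht]
    exact hs1 _ (ht.inter hs) Set.inter_subset_right
  have hle2 : μ.restrict sᶜ ≤ ν.restrict sᶜ := by
    refine Measure.le_iff.2 fun t ht => ?_
    rw [Measure.restrict_apply ht, Measure.restrict_apply ht]
    exact hs2 _ (ht.inter hs.compl) Set.inter_subset_right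
  set α := μ.restrict s - ν.restrict s
  set α' := ν.restrict sᶜ - μ.restrict sᶜ
  set η := ν.restrict s + μ.restrict sᶜ with hη
  have hα : α + ν.restrict s = μ.restrict s := Measure.sub_add_cancel_of_le hle1
  have hα' : α' + μ.restrict sᶜ = ν.restrict sᶜ := Measure.sub_add_cancel_of_le hle2
  have hμeq : η + α = μ := by
    rw [hη, add_right_comm, add_comm _ α, hα, Measure.restrict_add_restrict_compl hs]
  have hνeq : η + α' = ν := by
    rw [hη, add_assoc, add_comm _ α', hα', Measure.restrict_add_restrict_compl hs]
  have hmass : α Set.univ = α' Set.univ := by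
    have h1 : η Set.univ + α Set.univ = 1 := by
      rw [← Measure.add_apply, hμeq, measure_univ]
    have h2 : η Set.univ + α' Set.univ = 1 := by
      rw [← Measure.add_apply, hνeq, measure_univ]
    exact (ENNReal.add_right_inj (measure_ne_top η _)).1 (h1.trans h2.symm)
  have hW : ∀ ρ : Measure E, IsFiniteMeasure ρ → Integrable (fun x => ‖x‖) ρ →
      Integrable (fun x => 1 + b * ‖x‖) ρ := fun ρ _ hρ =>
    (integrable_const 1).add (hρ.const_mul b)
  have hWμ := hW μ inferInstance hμ
  have hWν := hW ν inferInstance hν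
  have hWμn : Integrable (fun x => -(1 + b * ‖x‖)) μ := hWμ.neg
  have hWνn : Integrable (fun x => -(1 + b * ‖x‖)) ν := hWν.neg
  have hαμ : α ≤ μ := hμeq ▸ Measure.le_add_left le_rfl
  have hαν : α' ≤ ν := hνeq ▸ Measure.le_add_left le_rfl
  classical
  have hφ := h (s.piecewise (fun x => 1 + b * ‖x‖) (fun x => -(1 + b * ‖x‖)))
    (Measurable.piecewise hs (by fun_prop) (by fun_prop)) (fun x y => by
      have hx : 0 ≤ b * ‖x‖ := by positivity
      have hy : 0 ≤ b * ‖y‖ := by positivity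
      by_cases h1 : x ∈ s <;> by_cases h2 : y ∈ s <;> simp [h1, h2] <;> linarith)
  rw [integral_piecewise hs hWμ.integrableOn hWμn.integrableOn,
    integral_piecewise hs hWν.integrableOn hWνn.integrableOn, ← hα, ← hα',
    integral_add_measure (hWμ.mono_measure hαμ) hWν.restrict,
    integral_add_measure (hWνn.mono_measure hαν) hWμn.restrict] at hφ
  have hlow : ∀ ρ : Measure E, IsFiniteMeasure ρ → Integrable (fun x => ‖x‖) ρ →
      b * ∫ x, ‖x‖ ∂ρ ≤ ∫ x, (1 + b * ‖x‖) ∂ρ := fun ρ hρ hi => by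
    rw [← integral_const_mul]
    exact integral_mono (hi.const_mul b) (hW ρ hρ hi) fun x => by simp
  have h1 := hlow α inferInstance (hμ.mono_measure hαμ)
  have h2 := hlow α' inferInstance (hν.mono_measure hαν)
  have hsum : ∫ x, ‖x‖ ∂α + ∫ x, ‖x‖ ∂α' ≤ b⁻¹ * δ := by
    rw [le_inv_mul_iff₀ hb]
    simp only [integral_neg] at hφ
    linarith
  have hconv : ∀ ρ : Measure E, Integrable (fun x => ‖x‖) ρ →
      ∫⁻ x, ‖x‖ₑ ∂ρ = ENNReal.ofReal (∫ x, ‖x‖ ∂ρ) := fun ρ hρ => by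
    rw [ofReal_integral_eq_lintegral_ofReal hρ (Filter.Eventually.of_forall fun _ => norm_nonneg _)]
    simp
  have hfin := wasserstein_one_le_of_common_part (α := α) (α' := α') (η := η) hmass
  rw [hμeq, hνeq, hconv α (hμ.mono_measure hαμ), hconv α' (hν.mono_measure hαν),
    ← ENNReal.ofReal_add (integral_nonneg fun _ => norm_nonneg _)
      (integral_nonneg fun _ => norm_nonneg _)] at hfin
  exact hfin.trans (ENNReal.ofReal_le_ofReal hsum)

end Wasserstein

/-! ### From drift and minorization to geometric convergence -/

section Convergence

open ProbabilityTheory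

theorem exists_convergesGeometricallyW1 {m : ℕ} (κ : Kernel (Vec m) (Vec m)) [IsMarkovKernel κ]
    {step : Measure (Vec m) → Measure (Vec m)}
    (hstep : ∀ μ : Measure (Vec m), IsProbabilityMeasure μ → step μ = κ ∘ₘ μ)
    {π : Measure (Vec m)} [IsProbabilityMeasure π] (hπ : Integrable (fun q => ‖q‖) π)
    (hinv : step π = π) (hi : ∀ x, Integrable (fun q => ‖q‖) (κ x)) {γ K : ℝ} (hγ0 : 0 ≤ γ)
    (hγ1 : γ < 1) (hK : 0 ≤ K) (hdrift : ∀ x, ∫ y, ‖y‖ ∂κ x ≤ γ * ‖x‖ + K)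
    (hminor : ∀ D : ℝ, ∃ ε > 0, ∀ x y : Vec m, ‖x‖ ≤ D → ‖y‖ ≤ D →
      ∃ ν : Measure (Vec m), ν ≤ κ x ∧ ν ≤ κ y ∧ ε ≤ ν.real Set.univ) (r₀ : ℝ) :
    ∃ ε : ℝ, 0 < ε ∧ ε < 1 ∧ ConvergesGeometricallyW1 step π (max (1 - ε) r₀) := by
  obtain ⟨b, hb, r, hr0, hr1, hcontr⟩ := exists_contraction_of_drift_of_minorization κ
    (V := fun q => ‖q‖) (fun _ => norm_nonneg _) hi hγ0 hγ1 hK hdrift hminor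
  -- The summand 1 in `C` pays for the initial moment, whose coefficient `b⁻¹ * b` is 1.
  refine ⟨1 - r, by linarith, by linarith, b⁻¹ * (2 + b * ∫ q, ‖q‖ ∂π) + 1,
    fun μ₀ hμ₀ hμi n => ?_⟩
  rw [sub_sub_cancel]
  have hprob : ∀ n, IsProbabilityMeasure (step^[n] μ₀) := fun n => by
    induction n with
    | zero => exact hμ₀
    | succ n ih =>
      rw [Function.iterate_succ_apply', hstep _ ih]
      infer_instance
  have hint : ∀ n, Integrable (fun q => ‖q‖) (step^[n] μ₀) := fun n => by
    induction n with
    | zero => exact hμi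
    | succ n ih =>
      have := hprob n
      rw [Function.iterate_succ_apply', hstep _ this]
      exact integrable_comp_of_drift κ measurable_norm (fun _ => norm_nonneg _) hi hdrift _ ih
  have hW : ∀ ρ : Measure (Vec m), IsFiniteMeasure ρ → Integrable (fun x => ‖x‖) ρ →
      Integrable (fun x => 1 + b * ‖x‖) ρ := fun ρ _ hρ =>
    (integrable_const 1).add (hρ.const_mul b)
  have hWcomp : ∀ μ : Measure (Vec m), IsProbabilityMeasure μ →
      Integrable (fun x => 1 + b * ‖x‖) μ → Integrable (fun x => 1 + b * ‖x‖) (κ ∘ₘ μ) := by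
    intro μ _ hμ
    refine hW _ inferInstance (integrable_comp_of_drift κ measurable_norm
      (fun _ => norm_nonneg _) hi hdrift μ ?_)
    have := (hμ.sub (integrable_const 1)).const_mul b⁻¹
    refine this.congr (Filter.Eventually.of_forall fun x => ?_)
    simp [hb.ne']
  have hWint : ∀ ρ : Measure (Vec m), IsProbabilityMeasure ρ → Integrable (fun x => ‖x‖) ρ →
      ∫ x, (1 + b * ‖x‖) ∂ρ = 1 + b * ∫ x, ‖x‖ ∂ρ := fun ρ _ hρ => by
    rw [integral_add (integrable_const 1) (hρ.const_mul b), integral_const_mul]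
    simp
  have hπconst : π = κ ∘ₘ π := by
    conv_lhs => rw [← hinv, hstep π inferInstance]
  have hdiff := integral_iterate_sub_le κ hr0 hWcomp hcontr (μ := fun n => step^[n] μ₀)
    (ν := fun _ => π) hprob (fun _ => inferInstance)
    (fun n => by simp only [Function.iterate_succ_apply']; exact hstep _ (hprob n))
    (fun _ => hπconst) (hW _ inferInstance hμi) (hW _ inferInstance hπ) n
  have := hprob n
  refine (wasserstein_one_le_of_integral_sub_le (hint n) hπ hb hdiff).trans ?_
  apply ENNReal.ofReal_le_ofReal
  simp only [Function.iterate_zero, id_eq]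
  rw [hWint _ hμ₀ hμi, hWint _ inferInstance hπ]
  have hpow : r ^ n ≤ max r r₀ ^ n := by
    gcongr
    exact le_max_left _ _
  have hm : 0 ≤ ∫ q, ‖q‖ ∂μ₀ := integral_nonneg fun _ => norm_nonneg _
  have hp : 0 ≤ ∫ q, ‖q‖ ∂π := integral_nonneg fun _ => norm_nonneg _
  have hcoef : b⁻¹ * (1 + b * ∫ q, ‖q‖ ∂μ₀ + (1 + b * ∫ q, ‖q‖ ∂π)) ≤
      (b⁻¹ * (2 + b * ∫ q, ‖q‖ ∂π) + 1) * (1 + ∫ q, ‖q‖ ∂μ₀) := by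
    have e : b⁻¹ * (1 + b * ∫ q, ‖q‖ ∂μ₀ + (1 + b * ∫ q, ‖q‖ ∂π)) =
        b⁻¹ * (2 + b * ∫ q, ‖q‖ ∂π) + ∫ q, ‖q‖ ∂μ₀ := by
      field_simp
      ring
    have hA : 0 ≤ b⁻¹ * (2 + b * ∫ q, ‖q‖ ∂π) := by positivity
    rw [e]
    nlinarith [mul_nonneg hA hm]
  calc b⁻¹ * (r ^ n * (1 + b * ∫ q, ‖q‖ ∂μ₀ + (1 + b * ∫ q, ‖q‖ ∂π)))
      = b⁻¹ * (1 + b * ∫ q, ‖q‖ ∂μ₀ + (1 + b * ∫ q, ‖q‖ ∂π)) * r ^ n := by ring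
    _ ≤ _ := by gcongr

end Convergence

/-! ### Common lower bounds for transition laws -/

section Minorization

open Set Filter Topology Metric
open scoped NNReal

variable {m : ℕ}

theorem volume_image_le_of_lipschitzOnWith {K : ℝ≥0} {f : Vec m → Vec m} {s : Set (Vec m)}
    (hf : LipschitzOnWith K f s) : volume (f '' s) ≤ (K : ℝ≥0∞) ^ m * volume s := by
  have hH : (Measure.hausdorffMeasure (m : ℝ) : Measure (Vec m)).IsAddHaarMeasure := by
    simpa using MeasureTheory.isAddHaarMeasure_hausdorffMeasure (E := Vec m)
  have := hf.hausdorffMeasure_image_le (d := m) (Nat.cast_nonneg m)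
  rw [Measure.isAddLeftInvariant_eq_smul (volume : Measure (Vec m))
    (Measure.hausdorffMeasure (m : ℝ)), Measure.smul_apply, Measure.smul_apply,
    ENNReal.smul_def, ENNReal.smul_def, smul_eq_mul, smul_eq_mul, mul_left_comm]
  gcongr
  simpa using this

theorem le_gibbs_of_isCompact {W : Vec m → ℝ} (hW : Continuous W) {K : Set (Vec m)}
    (hK : IsCompact K) : ∃ c : ℝ≥0∞, c ≠ 0 ∧ c ≠ ∞ ∧ ∀ s ⊆ K, MeasurableSet s →
      c * volume s ≤ gibbs W s := by
  obtain ⟨B, hB⟩ := hK.bddAbove_image hW.continuousOn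
  refine ⟨ENNReal.ofReal (Real.exp (-B)), by simp [Real.exp_pos], ENNReal.ofReal_ne_top,
    fun s hsK hs => ?_⟩
  rw [gibbs, withDensity_apply _ hs, ← setLIntegral_const]
  refine setLIntegral_mono' hs fun x hx => ?_
  gcongr
  exact hB (mem_image_of_mem W (hsK hx))

/-- Strict differentiability in both variables jointly makes one linear map approximate `F (q, ·)`
for all `q` near `q₀`, so the inverse function theorem holds with uniform radii. Half the radius
absorbs the shift of the centre `F (q, p₀)`. -/
theorem exists_nhds_surjOn_of_hasStrictFDerivAt {F : Vec m × Vec m → Vec m}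
    {A : Vec m × Vec m →L[ℝ] Vec m} {q₀ p₀ : Vec m} (hA : HasStrictFDerivAt F A (q₀, p₀))
    (hdet : (A.comp (ContinuousLinearMap.inr ℝ (Vec m) (Vec m))).det ≠ 0) :
    ∃ N ∈ 𝓝 q₀, ∃ O ∈ 𝓝 (F (q₀, p₀)), ∃ (K : ℝ≥0) (δ : ℝ), ∀ q ∈ N,
      LipschitzOnWith K (fun p => F (q, p)) (closedBall p₀ δ) ∧
      SurjOn (fun p => F (q, p)) (closedBall p₀ δ) O := by
  set B := (A.comp (ContinuousLinearMap.inr ℝ (Vec m) (Vec m))).toContinuousLinearEquivOfDetNeZero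
    hdet
  have hB : (B : Vec m →L[ℝ] Vec m) = A.comp (ContinuousLinearMap.inr ℝ (Vec m) (Vec m)) :=
    ContinuousLinearMap.coe_toContinuousLinearEquivOfDetNeZero _ hdet
  -- The `+ 1` keeps `k` positive in dimension 0.
  set k : ℝ≥0 := ‖(B.symm : Vec m →L[ℝ] Vec m)‖₊ + 1 with hk
  have hkpos : 0 < k := by positivity
  obtain ⟨Binv, hBinv⟩ : ∃ Binv : (B : Vec m →L[ℝ] Vec m).NonlinearRightInverse,
      Binv.nnnorm = k := ⟨
    { toFun := B.symm
      nnnorm := k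
      bound' := fun y => by
        refine ((B.symm : Vec m →L[ℝ] Vec m).le_opNorm y).trans ?_
        gcongr
        rw [hk]
        push_cast
        linarith
      right_inv' := B.apply_symm_apply }, rfl⟩
  set c : ℝ≥0 := (2 * k)⁻¹ with hc
  have hcpos : 0 < c := by positivity
  obtain ⟨s, hs, happrox⟩ := hA.approximates_deriv_on_nhds (Or.inr hcpos)
  obtain ⟨K, s', hs', hlip⟩ := hA.exists_lipschitzOnWith
  obtain ⟨δ, hδ, hsub⟩ := nhds_basis_closedBall.mem_iff.1 (inter_mem hs hs')
  rw [← closedBall_prod_same] at hsub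
  have hmem : ∀ q ∈ closedBall q₀ δ, ∀ p ∈ closedBall p₀ δ, (q, p) ∈ s ∩ s' :=
    fun q hq p hp => hsub (mk_mem_prod hq hp)
  have hρ : 0 < ((k : ℝ)⁻¹ - c) * δ := by
    refine mul_pos ?_ hδ
    rw [hc]
    push_cast
    rw [sub_pos]
    have : (0 : ℝ) < k := hkpos
    gcongr
    linarith
  have hcont : ContinuousAt (fun q => F (q, p₀)) q₀ :=
    ContinuousAt.comp (f := fun q => (q, p₀)) (g := F) hA.continuousAt (by fun_prop)
  refine ⟨closedBall q₀ δ ∩ (fun q => F (q, p₀)) ⁻¹' ball (F (q₀, p₀)) (((k : ℝ)⁻¹ - c) * δ / 2),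
    inter_mem (closedBall_mem_nhds _ hδ) (hcont (ball_mem_nhds _ (by positivity))),
    ball (F (q₀, p₀)) (((k : ℝ)⁻¹ - c) * δ / 2), ball_mem_nhds _ (by positivity), K, δ,
    fun q ⟨hq, hq'⟩ => ⟨?_, ?_⟩⟩
  · refine LipschitzOnWith.of_dist_le_mul fun p hp p' hp' => ?_
    have := hlip.dist_le_mul (q, p) (hmem q hq p hp).2 (q, p') (hmem q hq p' hp').2
    simpa [Prod.dist_eq] using this
  · have hlin : ApproximatesLinearOn (fun p => F (q, p)) (B : Vec m →L[ℝ] Vec m)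
        (closedBall p₀ δ) c := by
      rw [hB]
      intro p hp p' hp'
      have := happrox (q, p) (hmem q hq p hp).1 (q, p') (hmem q hq p' hp').1
      simpa using this
    have hsurj := hlin.surjOn_closedBall_of_nonlinearRightInverse Binv hδ.le subset_rfl
    rw [hBinv] at hsurj
    refine hsurj.mono subset_rfl fun y hy => ?_
    rw [mem_ball] at hy
    have hq'' : dist (F (q, p₀)) (F (q₀, p₀)) < ((k : ℝ)⁻¹ - c) * δ / 2 := hq'
    rw [mem_closedBall]
    calc dist y (F (q, p₀)) ≤ dist y (F (q₀, p₀)) + dist (F (q, p₀)) (F (q₀, p₀)) :=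
          dist_triangle_right _ _ _
      _ ≤ ((k : ℝ)⁻¹ - c) * δ := by linarith

/-- A Lipschitz map covering `t ∩ O'` needs a preimage of comparable volume, and the Gibbs density
is bounded below on the compact ball containing it. -/
theorem exists_nhds_smul_restrict_le_map {F : Vec m × Vec m → Vec m} (hF : Continuous F)
    {V : Vec m → ℝ} (hV : Continuous V) {A : Vec m × Vec m →L[ℝ] Vec m} {q₀ p₀ : Vec m}
    (hA : HasStrictFDerivAt F A (q₀, p₀))
    (hdet : (A.comp (ContinuousLinearMap.inr ℝ (Vec m) (Vec m))).det ≠ 0) :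
    ∃ N ∈ 𝓝 q₀, ∃ O ∈ 𝓝 (F (q₀, p₀)), ∃ c : ℝ≥0∞, c ≠ 0 ∧ ∀ q ∈ N,
      c • volume.restrict O ≤ (gibbs V).map fun p => F (q, p) := by
  obtain ⟨N, hN, O, hO, K, δ, H⟩ := exists_nhds_surjOn_of_hasStrictFDerivAt hA hdet
  obtain ⟨e, he0, -, he⟩ := le_gibbs_of_isCompact hV (isCompact_closedBall p₀ δ)
  obtain ⟨O', hO'O, hO', hmem⟩ := _root_.mem_nhds_iff.1 hO
  set k : ℝ≥0∞ := ((K + 1 : ℝ≥0) : ℝ≥0∞) ^ m with hk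
  have hk0 : k ≠ 0 := pow_ne_zero _ (by simp)
  have hktop : k ≠ ∞ := ENNReal.pow_ne_top ENNReal.coe_ne_top
  refine ⟨N, hN, O', hO'.mem_nhds hmem, e * k⁻¹, mul_ne_zero he0 (ENNReal.inv_ne_zero.2 hktop),
    fun q hq => ?_⟩
  obtain ⟨hlip, hsurj⟩ := H q hq
  have hFq : Continuous fun p => F (q, p) := by fun_prop
  refine Measure.le_iff.2 fun t ht => ?_
  rw [Measure.smul_apply, Measure.restrict_apply ht, smul_eq_mul,
    Measure.map_apply hFq.measurable ht]
  set S := closedBall p₀ δ ∩ (fun p => F (q, p)) ⁻¹' t with hS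
  have hSm : MeasurableSet S := measurableSet_closedBall.inter (hFq.measurable ht)
  have hsub : t ∩ O' ⊆ (fun p => F (q, p)) '' S := by
    rintro y ⟨hyt, hyO⟩
    obtain ⟨p, hp, rfl⟩ := hsurj (hO'O hyO)
    exact ⟨p, ⟨hp, hyt⟩, rfl⟩
  have hvol : volume (t ∩ O') ≤ k * volume S := by
    refine (measure_mono hsub).trans (volume_image_le_of_lipschitzOnWith ?_)
    exact (hlip.mono inter_subset_left).weaken (by simp)
  calc e * k⁻¹ * volume (t ∩ O') ≤ e * k⁻¹ * (k * volume S) := by gcongr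
    _ = e * volume S := by
        rw [mul_assoc, ← mul_assoc k⁻¹, ENNReal.inv_mul_cancel hk0 hktop, one_mul]
    _ ≤ gibbs V S := he S inter_subset_left hSm
    _ ≤ gibbs V ((fun p => F (q, p)) ⁻¹' t) := measure_mono inter_subset_right

theorem exists_nhds_common_lower_bound {F : Vec m × Vec m → Vec m} (hF : Continuous F)
    (hd : ∀ x, ∃ A : Vec m × Vec m →L[ℝ] Vec m, HasStrictFDerivAt F A x)
    (hsurj : ∀ q, Function.Surjective fun p => F (q, p)) {V : Vec m → ℝ} (hV : Continuous V)
    (q₀ q₁ : Vec m) :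
    ∃ N₀ ∈ 𝓝 q₀, ∃ N₁ ∈ 𝓝 q₁, ∃ ν : Measure (Vec m), ν ≠ 0 ∧
      (∀ q ∈ N₀, ν ≤ (gibbs V).map fun p => F (q, p)) ∧
      ∀ q ∈ N₁, ν ≤ (gibbs V).map fun p => F (q, p) := by
  choose A hA using hd
  set D : Vec m → Vec m → Vec m →L[ℝ] Vec m := fun q p =>
    (A (q, p)).comp (ContinuousLinearMap.inr ℝ (Vec m) (Vec m)) with hDdef
  have hD : ∀ q p, HasFDerivAt (fun p => F (q, p)) (D q p) p := fun q p =>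
    HasFDerivAt.comp (g := F) (f := fun p => (q, p)) p (hA (q, p)).hasFDerivAt
      (hasFDerivAt_prodMk_right q p)
  have hnull : ∀ q, volume ((fun p => F (q, p)) '' {p | (D q p).det = 0}) = 0 := fun q =>
    addHaar_image_eq_zero_of_det_fderivWithin_eq_zero volume
      (fun p _ => (hD q p).hasFDerivWithinAt) fun p hp => hp
  -- Sard: both sets of critical values are null, so they cannot cover the space.
  obtain ⟨y, hy⟩ : ∃ y, y ∉ (fun p => F (q₀, p)) '' {p | (D q₀ p).det = 0} ∪
      (fun p => F (q₁, p)) '' {p | (D q₁ p).det = 0} := by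
    by_contra! hall
    have h1 := measure_union_null (hnull q₀) (hnull q₁)
    rw [eq_univ_of_forall hall] at h1
    exact isOpen_univ.measure_ne_zero volume univ_nonempty h1
  rw [mem_union, not_or] at hy
  obtain ⟨p₀, hp₀⟩ := hsurj q₀ y
  obtain ⟨p₁, hp₁⟩ := hsurj q₁ y
  simp only at hp₀ hp₁
  obtain ⟨N₀, hN₀, O₀, hO₀, c₀, hc₀, H₀⟩ := exists_nhds_smul_restrict_le_map hF hV
    (hA (q₀, p₀)) fun h => hy.1 ⟨p₀, h, hp₀⟩
  obtain ⟨N₁, hN₁, O₁, hO₁, c₁, hc₁, H₁⟩ := exists_nhds_smul_restrict_le_map hF hV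
    (hA (q₁, p₁)) fun h => hy.2 ⟨p₁, h, hp₁⟩
  rw [hp₀] at hO₀
  rw [hp₁] at hO₁
  refine ⟨N₀, hN₀, N₁, hN₁, min c₀ c₁ • volume.restrict (O₀ ∩ O₁), ?_, fun q hq => ?_,
    fun q hq => ?_⟩
  · rw [← Measure.measure_univ_ne_zero]
    simp only [Measure.smul_apply, Measure.restrict_apply_univ, smul_eq_mul]
    refine mul_ne_zero ?_ (Measure.measure_pos_of_mem_nhds volume (inter_mem hO₀ hO₁)).ne'
    rcases min_choice c₀ c₁ with h | h <;> rw [h] <;> assumption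
  · refine le_trans ?_ (H₀ q hq)
    gcongr
    · exact min_le_left _ _
    · exact inter_subset_left
  · refine le_trans ?_ (H₁ q hq)
    gcongr
    · exact min_le_right _ _
    · exact inter_subset_right

theorem exists_uniform_minorization (κ : Vec m → Measure (Vec m))
    (hκ : ∀ q, IsProbabilityMeasure (κ q))
    (hlocal : ∀ q₀ q₁, ∃ N₀ ∈ 𝓝 q₀, ∃ N₁ ∈ 𝓝 q₁, ∃ ν : Measure (Vec m), ν ≠ 0 ∧
      (∀ q ∈ N₀, ν ≤ κ q) ∧ ∀ q ∈ N₁, ν ≤ κ q) (D : ℝ) :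
    ∃ ε > 0, ∀ x y : Vec m, ‖x‖ ≤ D → ‖y‖ ≤ D →
      ∃ ν : Measure (Vec m), ν ≤ κ x ∧ ν ≤ κ y ∧ ε ≤ ν.real univ := by
  have hcomp : IsCompact (closedBall (0 : Vec m) D ×ˢ closedBall (0 : Vec m) D) :=
    (isCompact_closedBall _ _).prod (isCompact_closedBall _ _)
  obtain ⟨ε, hε, H⟩ := hcomp.induction_on
    (p := fun S => ∃ ε > 0, ∀ z ∈ S,
      ∃ ν : Measure (Vec m), ν ≤ κ z.1 ∧ ν ≤ κ z.2 ∧ ε ≤ ν.real univ)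
    ⟨1, one_pos, fun z hz => hz.elim⟩
    (fun s t hst ⟨ε, hε, H⟩ => ⟨ε, hε, fun z hz => H z (hst hz)⟩)
    (fun s t ⟨ε, hε, H⟩ ⟨ε', hε', H'⟩ => ⟨min ε ε', lt_min hε hε', fun z hz => by
      rcases hz with hz | hz
      · obtain ⟨ν, h1, h2, h3⟩ := H z hz
        exact ⟨ν, h1, h2, (min_le_left _ _).trans h3⟩
      · obtain ⟨ν, h1, h2, h3⟩ := H' z hz
        exact ⟨ν, h1, h2, (min_le_right _ _).trans h3⟩⟩)
    (fun z _ => by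
      obtain ⟨N₀, hN₀, N₁, hN₁, ν, hν, h0, h1⟩ := hlocal z.1 z.2
      refine ⟨N₀ ×ˢ N₁, mem_nhdsWithin_of_mem_nhds (prod_mem_nhds hN₀ hN₁), ν.real univ, ?_,
        fun w hw => ⟨ν, h0 _ hw.1, h1 _ hw.2, le_rfl⟩⟩
      have hfin : IsFiniteMeasure ν := by
        have := hκ z.1
        exact isFiniteMeasure_of_le _ (h0 z.1 (mem_of_mem_nhds hN₀))
      exact ENNReal.toReal_pos (Measure.measure_univ_ne_zero.2 hν) (measure_ne_top ν _))
  exact ⟨ε, hε, fun x y hx hy => H (x, y) ⟨by simpa using hx, by simpa using hy⟩⟩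

end Minorization

/-! ### Linear growth of the position and its first moment -/

section Drift

variable {m : ℕ} {U V : Vec m → ℝ} {Q P : ℝ → Vec m → Vec m → Vec m}

theorem SensitivityBound.exists_lipschitz {t R β : ℝ} (h : SensitivityBound Q t R β)
    (hd : ∀ p, Differentiable ℝ fun q => Q t q p) :
    ∃ L, 0 ≤ L ∧ ∀ q q' p, ‖Q t q p - Q t q' p‖ ≤ L * ‖q - q'‖ := by
  obtain ⟨hout, M, hin⟩ := h
  refine ⟨max (max β M) 0, le_max_right _ _, fun q q' p => ?_⟩
  refine convex_univ.norm_image_sub_le_of_norm_fderiv_le (𝕜 := ℝ) (f := fun x => Q t x p)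
    (fun x _ => hd p x) (fun x _ => ?_) (Set.mem_univ q') (Set.mem_univ q)
  rcases lt_or_ge R ‖x‖ with hx | hx
  · exact (hout x p hx).trans ((le_max_left _ _).trans (le_max_left _ _))
  · exact (hin x p hx).trans ((le_max_right _ _).trans (le_max_left _ _))

theorem SensitivityBound.exists_norm_le {t R β : ℝ} (h : SensitivityBound Q t R β) (hR : 0 < R)
    (hd : ∀ p, Differentiable ℝ fun q => Q t q p) :
    ∃ K, 0 ≤ K ∧ ∀ q p, ‖Q t q p‖ ≤ max β 0 * ‖q‖ + (‖Q t 0 p‖ + K) := by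
  obtain ⟨L, hL, hlip⟩ := h.exists_lipschitz hd
  have hball : ∀ q p, ‖q‖ ≤ R → ‖Q t q p‖ ≤ ‖Q t 0 p‖ + L * R := fun q p hq => by
    have h1 := hlip q 0 p
    rw [sub_zero] at h1
    have h2 := norm_le_norm_add_norm_sub' (Q t q p) (Q t 0 p)
    have h3 : L * ‖q‖ ≤ L * R := by gcongr
    linarith
  refine ⟨L * R, by positivity, fun q p => ?_⟩
  have hβ : 0 ≤ max β 0 * ‖q‖ := by positivity
  rcases le_or_gt ‖q‖ R with hq | hq
  · linarith [hball q p hq]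
  · have hqpos : 0 < ‖q‖ := hR.trans hq
    set a := R / ‖q‖ with ha
    have ha0 : 0 < a := by positivity
    have ha1 : a < 1 := (div_lt_one hqpos).2 hq
    have haq : a * ‖q‖ = R := by rw [ha]; field_simp
    have hc : ∀ s : ℝ, HasDerivAt (fun s : ℝ => (1 - s * (1 - a)) • q) (-(1 - a) • q) s := by
      intro s
      have := (((hasDerivAt_id s).mul_const (1 - a)).const_sub 1).smul_const q
      simpa using this
    have hg : ∀ s : ℝ, HasDerivAt (fun s : ℝ => Q t ((1 - s * (1 - a)) • q) p)
        (fderiv ℝ (fun x => Q t x p) ((1 - s * (1 - a)) • q) (-(1 - a) • q)) s := fun s =>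
      HasFDerivAt.comp_hasDerivAt (l := fun x => Q t x p) s (hd p _).hasFDerivAt (hc s)
    -- The path runs radially from `q` to the sphere of radius `R`. The derivative bound is needed
    -- only for `s < 1`, where the point is strictly outside the ball.
    have hseg := norm_image_sub_le_of_norm_deriv_right_le_segment (a := 0) (b := 1)
      (f := fun s : ℝ => Q t ((1 - s * (1 - a)) • q) p)
      (C := max β 0 * ‖q‖)
      (fun s _ => (hg s).continuousAt.continuousWithinAt) (fun s _ => (hg s).hasDerivWithinAt)
      (fun s hs => by
        have hfac : a < 1 - s * (1 - a) := by nlinarith [hs.2]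
        have hnorm : R < ‖(1 - s * (1 - a)) • q‖ := by
          rw [norm_smul, Real.norm_of_nonneg (by linarith), ← haq]
          gcongr
        have hdir : ‖-(1 - a) • q‖ ≤ ‖q‖ := by
          rw [norm_smul, norm_neg, Real.norm_of_nonneg (by linarith)]
          exact mul_le_of_le_one_left hqpos.le (by linarith)
        refine (ContinuousLinearMap.le_opNorm _ _).trans ?_
        exact mul_le_mul ((h.1 _ p hnorm).trans (le_max_left _ _)) hdir (norm_nonneg _)
          (le_max_right _ _)) 1 (by simp)
    simp only [one_mul, sub_sub_cancel, zero_mul, sub_zero, one_smul, mul_one] at hseg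
    have hRq : ‖a • q‖ ≤ R := by rw [norm_smul, Real.norm_of_nonneg ha0.le, haq]
    have h1 := norm_le_norm_add_norm_sub (Q t (a • q) p) (Q t q p)
    linarith [hball _ p hRq]

/-- By invariance the position after the motion has finite mean under π ⊗ G, so by Fubini for some
fixed `q`; the Lipschitz bound moves `q` to 0. -/
theorem IsHamiltonianMotion.integrable_norm_position_zero (h : IsHamiltonianMotion U V Q P)
    (hU : ContDiff ℝ 2 U) (hV : ContDiff ℝ 2 V) [hUprob : IsProbabilityMeasure (gibbs U)]
    [hVprob : IsProbabilityMeasure (gibbs V)] (hUmoment : Integrable (fun q => ‖q‖) (gibbs U))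
    {t R β : ℝ} (hs : SensitivityBound Q t R β) :
    Integrable (fun p => ‖Q t 0 p‖) (gibbs V) := by
  have hc := h.continuous_position hU hV t
  rw [← h.hmcStep_gibbs hU hV hVprob t, hmcStep,
    integrable_map_measure continuous_norm.aestronglyMeasurable hc.aemeasurable] at hUmoment
  obtain ⟨q, hq⟩ := hUmoment.prod_right_ae.exists
  obtain ⟨L, -, hlip⟩ := hs.exists_lipschitz (h.differentiable_position hU hV t)
  have hc0 : Continuous fun p => Q t 0 p := hc.comp (f := fun p => (0, p)) (by fun_prop)
  refine (hq.add (integrable_const (L * ‖q‖))).mono' hc0.norm.aestronglyMeasurable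
    (Filter.Eventually.of_forall fun p => ?_)
  have h1 := hlip 0 q p
  rw [zero_sub, norm_neg] at h1
  have h2 := norm_le_norm_add_norm_sub' (Q t 0 p) (Q t q p)
  rw [norm_norm]
  simp only [Pi.add_apply, Function.comp_apply]
  linarith

end Drift

/-! ### Transition kernels, their drift and minorization -/

section Kernels

open ProbabilityTheory

variable {m : ℕ} {U V : Vec m → ℝ} {Q P : ℝ → Vec m → Vec m → Vec m}

/-- The transition kernel of the chain that moves from `q` to `Q t q p` with `p` drawn from `G`. -/
noncomputable def hmcKernel (Q : ℝ → Vec m → Vec m → Vec m) (G : Measure (Vec m)) (t : ℝ) :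
    Kernel (Vec m) (Vec m) :=
  (Kernel.id ×ₖ Kernel.const (Vec m) G).map fun z => Q t z.1 z.2

theorem hmcKernel_apply {G : Measure (Vec m)} [IsProbabilityMeasure G] {t : ℝ}
    (hQ : Measurable fun z : Vec m × Vec m => Q t z.1 z.2) (q : Vec m) :
    hmcKernel Q G t q = G.map (Q t q) := by
  rw [hmcKernel, Kernel.map_apply _ hQ, Kernel.prod_apply, Kernel.id_apply, Kernel.const_apply,
    Measure.dirac_prod, Measure.map_map hQ measurable_prodMk_left]
  rfl

theorem isMarkovKernel_hmcKernel {G : Measure (Vec m)} [IsProbabilityMeasure G] {t : ℝ}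
    (hQ : Measurable fun z : Vec m × Vec m => Q t z.1 z.2) : IsMarkovKernel (hmcKernel Q G t) :=
  Kernel.IsMarkovKernel.map _ hQ

theorem hmcStep_eq_comp {G : Measure (Vec m)} [IsProbabilityMeasure G] {t : ℝ}
    (hQ : Measurable fun z : Vec m × Vec m => Q t z.1 z.2) (μ : Measure (Vec m))
    [IsProbabilityMeasure μ] : hmcStep Q G t μ = hmcKernel Q G t ∘ₘ μ := by
  rw [hmcKernel, ← Measure.map_comp _ _ hQ, ← Measure.compProd_eq_comp_prod,
    Measure.compProd_const, hmcStep]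

theorem IsHamiltonianMotion.exists_drift (h : IsHamiltonianMotion U V Q P)
    (hU : ContDiff ℝ 2 U) (hV : ContDiff ℝ 2 V) [IsProbabilityMeasure (gibbs U)]
    [IsProbabilityMeasure (gibbs V)] (hUmoment : Integrable (fun q => ‖q‖) (gibbs U))
    {t R β : ℝ} (hR : 0 < R) (hs : SensitivityBound Q t R β) :
    (∀ q, Integrable (fun y => ‖y‖) (hmcKernel Q (gibbs V) t q)) ∧
      ∃ K, 0 ≤ K ∧ ∀ q, ∫ y, ‖y‖ ∂hmcKernel Q (gibbs V) t q ≤ max β 0 * ‖q‖ + K := by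
  have hc := h.continuous_position hU hV t
  obtain ⟨K, hK, hbound⟩ := hs.exists_norm_le hR (h.differentiable_position hU hV t)
  have h0 := h.integrable_norm_position_zero hU hV hUmoment hs
  have hcq : ∀ q, Continuous (Q t q) := fun q => hc.comp (f := fun p => (q, p)) (by fun_prop)
  have h1 : Integrable (fun p => ‖Q t 0 p‖ + K) (gibbs V) := h0.add (integrable_const K)
  have hdom : ∀ q : Vec m, Integrable (fun p => max β 0 * ‖q‖ + (‖Q t 0 p‖ + K)) (gibbs V) :=
    fun q => (integrable_const _).add h1
  have hint : ∀ q, Integrable (fun p => ‖Q t q p‖) (gibbs V) := fun q =>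
    (hdom q).mono' (hcq q).norm.aestronglyMeasurable
      (Filter.Eventually.of_forall fun p => by rw [norm_norm]; exact hbound q p)
  refine ⟨fun q => ?_, ∫ p, ‖Q t 0 p‖ ∂gibbs V + K,
    add_nonneg (integral_nonneg fun p => norm_nonneg (Q t 0 p)) hK, fun q => ?_⟩
  · rw [hmcKernel_apply hc.measurable,
      integrable_map_measure continuous_norm.aestronglyMeasurable (hcq q).aemeasurable]
    exact hint q
  · rw [hmcKernel_apply hc.measurable,
      integral_map (hcq q).aemeasurable continuous_norm.aestronglyMeasurable]
    refine (integral_mono (hint q) (hdom q) (hbound q)).trans_eq ?_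
    rw [integral_add (integrable_const _) h1,
      integral_add h0 (integrable_const _)]
    simp

theorem IsHamiltonianMotion.exists_minorization (h : IsHamiltonianMotion U V Q P)
    (hU : ContDiff ℝ 2 U) (hV : ContDiff ℝ 2 V) [IsProbabilityMeasure (gibbs V)] {t : ℝ}
    (hcov : ∀ q, Function.Surjective fun p => Q t q p) (D : ℝ) :
    ∃ ε > 0, ∀ x y : Vec m, ‖x‖ ≤ D → ‖y‖ ≤ D → ∃ ν : Measure (Vec m),
      ν ≤ hmcKernel Q (gibbs V) t x ∧ ν ≤ hmcKernel Q (gibbs V) t y ∧ ε ≤ ν.real Set.univ := by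
  have hc := h.continuous_position hU hV t
  have hM := isMarkovKernel_hmcKernel (G := gibbs V) hc.measurable
  refine exists_uniform_minorization _ (fun q => hM.isProbabilityMeasure q) (fun q₀ q₁ => ?_) D
  simp only [hmcKernel_apply hc.measurable]
  exact exists_nhds_common_lower_bound hc (h.hasStrictFDerivAt_position hU hV t) hcov
    hV.continuous q₀ q₁

theorem comp_mono_of_le {X Y : Type*} [MeasurableSpace X] [MeasurableSpace Y] (κ : Kernel X Y)
    {μ ν : Measure X} (h : μ ≤ ν) : κ ∘ₘ μ ≤ κ ∘ₘ ν := by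
  refine Measure.le_iff.2 fun s hs => ?_
  rw [Measure.bind_apply hs κ.aemeasurable, Measure.bind_apply hs κ.aemeasurable]
  exact lintegral_mono' h le_rfl

end Kernels

/-! ### The theorem for both chains -/

open ProbabilityTheory in
theorem theorem3 {m : ℕ} (U V : Vec m → ℝ) (hU : ContDiff ℝ 2 U) (hV : ContDiff ℝ 2 V)
    (hUprob : IsProbabilityMeasure (gibbs U)) (hVprob : IsProbabilityMeasure (gibbs V))
    (hUmoment : Integrable (fun q => ‖q‖) (gibbs U))
    (Q P : ℝ → Vec m → Vec m → Vec m) (hmotion : IsHamiltonianMotion U V Q P)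
    (T : ℝ) (hT : 0 < T) (hcoverage : ∀ q : Vec m, Function.Surjective (fun p => Q T q p))
    (R : ℝ) (hR : 0 < R) (β : ℝ) (hβ : β < 1) (hforward : SensitivityBound Q T R β) :
    (∃ ε : ℝ, 0 < ε ∧ ε < 1 ∧
      ConvergesGeometricallyW1 (hmcStep Q (gibbs V) T) (gibbs U) (max (1 - ε) ((1 + β) / 2))) ∧
    (SensitivityBound Q (-T) R β →
      ∃ ε : ℝ, 0 < ε ∧ ε < 1 ∧
        ConvergesGeometricallyW1 (adHmcStep Q (gibbs V) T) (gibbs U)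
          (max (1 - ε) ((1 + β) / 2))) := by
  have hQ : ∀ t, Measurable fun z : Vec m × Vec m => Q t z.1 z.2 := fun t =>
    (hmotion.continuous_position hU hV t).measurable
  have hM : ∀ t, IsMarkovKernel (hmcKernel Q (gibbs V) t) := fun t =>
    isMarkovKernel_hmcKernel (hQ t)
  -- In dimension 0 the bound outside the ball is vacuous and `β` may be negative, hence `max β 0`.
  have hγ0 : 0 ≤ max β 0 := le_max_right _ _
  have hγ1 : max β 0 < 1 := max_lt hβ one_pos
  obtain ⟨hi, K, hK, hdrift⟩ := hmotion.exists_drift hU hV hUmoment hR hforward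
  have hminor := hmotion.exists_minorization hU hV hcoverage
  refine ⟨exists_convergesGeometricallyW1 (hmcKernel Q (gibbs V) T)
    (fun μ _ => hmcStep_eq_comp (hQ T) μ) hUmoment (hmotion.hmcStep_gibbs hU hV hVprob T) hi hγ0
    hγ1 hK hdrift hminor _, fun hbackward => ?_⟩
  obtain ⟨hi', K', hK', hdrift'⟩ := hmotion.exists_drift hU hV hUmoment hR hbackward
  have hi'' : ∀ q, Integrable (fun y => ‖y‖)
      (hmcKernel Q (gibbs V) (-T) ∘ₘ hmcKernel Q (gibbs V) T q) := fun q =>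
    integrable_comp_of_drift _ measurable_norm (fun _ => norm_nonneg _) hi' hdrift' _ (hi q)
  refine exists_convergesGeometricallyW1
    (hmcKernel Q (gibbs V) (-T) ∘ₖ hmcKernel Q (gibbs V) T) (fun μ _ => ?_) hUmoment ?_
    (fun q => by rw [Kernel.comp_apply]; exact hi'' q) hγ0 hγ1 (add_nonneg hK hK') (fun q => ?_)
    (fun D => ?_) _
  · have : IsProbabilityMeasure (hmcKernel Q (gibbs V) T ∘ₘ μ) := inferInstance
    rw [adHmcStep, hmcStep_eq_comp (hQ T), hmcStep_eq_comp (hQ (-T)), Measure.comp_assoc]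
  · rw [adHmcStep, hmotion.hmcStep_gibbs hU hV hVprob, hmotion.hmcStep_gibbs hU hV hVprob]
  · have hint := hi'' q
    rw [← Kernel.comp_apply] at hint
    rw [Kernel.integral_comp hint]
    have hstep := integral_mono_of_nonneg (μ := hmcKernel Q (gibbs V) T q)
      (f := fun x => ∫ y, ‖y‖ ∂hmcKernel Q (gibbs V) (-T) x)
      (Filter.Eventually.of_forall fun x => integral_nonneg fun _ => norm_nonneg _)
      (((hi q).const_mul (max β 0)).add (integrable_const K'))
      (Filter.Eventually.of_forall hdrift')
    refine hstep.trans ?_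
    simp only [Pi.add_apply]
    rw [integral_add ((hi q).const_mul _) (integrable_const K'), integral_const_mul]
    simp only [integral_const, probReal_univ, smul_eq_mul, one_mul]
    -- One contraction factor is enough: the backward one is replaced by 1, so the constants simply
    -- add.
    have h1 : max β 0 * ∫ y, ‖y‖ ∂hmcKernel Q (gibbs V) T q ≤
        1 * ∫ y, ‖y‖ ∂hmcKernel Q (gibbs V) T q :=
      mul_le_mul_of_nonneg_right hγ1.le (integral_nonneg fun _ => norm_nonneg _)
    linarith [hdrift q]
  · obtain ⟨ε, hε, H⟩ := hminor D
    refine ⟨ε, hε, fun x y hx hy => ?_⟩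
    obtain ⟨ν, h1, h2, h3⟩ := H x y hx hy
    -- A Markov kernel preserves order and total mass, so pushing the forward common part through
    -- the backward step keeps `ε`.
    refine ⟨hmcKernel Q (gibbs V) (-T) ∘ₘ ν, ?_, ?_, ?_⟩
    · rw [Kernel.comp_apply]
      exact comp_mono_of_le _ h1
    · rw [Kernel.comp_apply]
      exact comp_mono_of_le _ h2
    · have : (hmcKernel Q (gibbs V) (-T) ∘ₘ ν) Set.univ = ν Set.univ := by
        rw [Measure.bind_apply MeasurableSet.univ (Kernel.aemeasurable _)]
        simp
      rwa [measureReal_def, this]
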